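/- Let $D\ge 1$ be an integer and $k\in\frac1D\mathbb Z$. Fractional powers are principal: $z^{s}=\exp(s\log z)$ with $-\pi<\operatorname{Im}\log z\le\pi$. The $D$-cover $\widetilde{\mathrm{SL}_2(\mathbb R)^D}$ is the group of pairs $(\gamma,\varepsilon(c\tau+d)^{1/D})$, abbreviated $(\gamma,\varepsilon)$, with $\gamma=\begin{pmatrix}a&b\\c&d\end{pmatrix}\in\mathrm{SL}_2(\mathbb R)$ and $\varepsilon\in\mathbb C$, $\varepsilon^D=1$, with composition $(\gamma_1,\varphi_1(\tau))(\gamma_2,\varphi_2(\tau))=(\gamma_1\gamma_2,\varphi_1(\gamma_2\tau)\varphi_2(\tau))$. For a subgroup $G\subseteq\mathrm{SL}_2(\mathbb Z)$ let $\widetilde{G^D}$ be its preimage in this group and $\overline G$ its image in $\mathrm{PSL}_2(\mathbb Z)$. On functions on the upper half-plane $\mathfrak H$ put $$(f|_k(\gamma,\varepsilon))(\tau)=\varepsilon^{-Dk}(c\tau+d)^{-k}f\!\left(\frac{a\tau+b}{c\tau+d}\right).$$ Let $G\subseteq\mathrm{SL}_2(\mathbb Z)$ be a subgroup of finite index, and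 let $\chi\colon\widetilde{G^D}\to\mathbb C^\times$ be a character whose kernel has finite index. A meromorphic modular form of weight $k$ on $\widetilde{G^D}$ with multiplier system $\chi$ is a meromorphic function $f$ on $\mathfrak H$ such that $f|_k\gamma=\chi(\gamma)f$ for all $\gamma\in\widetilde{G^D}$ and such that $f$ is meromorphic at the cusps: for every $\gamma\in\widetilde{\mathrm{SL}_2(\mathbb Z)^D}$ there is an integer $m\ge1$ such that, for $\operatorname{Im}\tau$ large, $(f|_k\gamma)(\tau)=\sum_{n\in\frac1m\mathbb Z}a_nq^n$ with $q^n=e^{2\pi i n\tau}$ and with only finitely many nonzero $a_n$ with $n<0$. If $f\neq0$, then $\operatorname{ord}_{i\infty}(f|_k\gamma)\in\mathbb Q$ denotes the least $n$ with $a_n\ne0$, and $\operatorname{ord}_\tau(f)\in\mathbb Z$ the order of $f$ at $\tau\in\mathfrak H$. Then for every nonzero meromorphic modular form $f$ of weight $k$ on $\widetilde{G^D}$ with multiplier system $\chi$, all these orders are finite, $\operatorname{ord}_\tau(f)\neq0$ for only finitely many $\tau$ modulo $\overline G$, and $$\sum_{\overline\gamma\in\overline G\backslash\mathrm{PSL}_2(\mathbb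 Z)}\operatorname{ord}_{i\infty}(f|_k\gamma)+\sum_{\tau\in\overline G\backslash\mathfrak H}\frac1{|\overline G_\tau|}\operatorname{ord}_\tau(f)=\frac1{12}[\mathrm{PSL}_2(\mathbb Z):\overline G]\,k,$$ where $\overline G_\tau$ is the stabilizer of $\tau$ in $\overline G$, and where in the first sum $\gamma\in\widetilde{\mathrm{SL}_2(\mathbb Z)^D}$ is any element lying over a representative of the coset; both sums are independent of the choice of representatives. -/

import Mathlib

open UpperHalfPlane Matrix Filter Topology
open scoped MatrixGroups

noncomputable section

/-! ### The `D`-cover of `SL(2, ℝ)` -/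

/-- The factor `cτ + d`. -/
def autFactor (g : SL(2, ℝ)) (τ : ℍ) : ℂ := (g 1 0 : ℂ) * τ + (g 1 1 : ℂ)

/-- The principal branch `(cτ + d)^{1/D}` (with `-π < Im log ≤ π`). -/
def rootFactor (D : ℕ) (g : SL(2, ℝ)) (τ : ℍ) : ℂ := autFactor g τ ^ ((1 : ℂ) / D)

/-- The quantity `δ` of the composition law of the `D`-cover, for
`g = (a₁, b₁; c₁, d₁)`, `h = (a₂, b₂; c₂, d₂)`. -/
def coverDelta (D : ℕ) (g h : SL(2, ℝ)) (τ : ℍ) : ℂ :=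
  ((g 1 0 : ℂ) * (((h 0 0 : ℂ) * τ + (h 0 1 : ℂ)) / ((h 1 0 : ℂ) * τ + (h 1 1 : ℂ)))
      + (g 1 1 : ℂ)) ^ ((1 : ℂ) / D)
    * ((h 1 0 : ℂ) * τ + (h 1 1 : ℂ)) ^ ((1 : ℂ) / D)
    / ((g 1 0 : ℂ) * ((h 0 0 : ℂ) * τ + (h 0 1 : ℂ))
      + (g 1 1 : ℂ) * ((h 1 0 : ℂ) * τ + (h 1 1 : ℂ))) ^ ((1 : ℂ) / D)

theorem autFactor_ne_zero (g : SL(2, ℝ)) (τ : ℍ) : autFactor g τ ≠ 0 :=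
  denom_ne_zero (g : GL (Fin 2) ℝ) τ

theorem autFactor_mul (g h : SL(2, ℝ)) (τ : ℍ) :
    autFactor (g * h) τ = autFactor g (h • τ) * autFactor h τ := by
  have h0 : (h 1 0 : ℂ) * τ + (h 1 1 : ℂ) ≠ 0 := autFactor_ne_zero h τ
  simp only [autFactor, coe_specialLinearGroup_apply, Matrix.SpecialLinearGroup.coe_mul,
    Matrix.mul_apply, Fin.sum_univ_two, Complex.ofReal_add, Complex.ofReal_mul,
    Algebra.algebraMap_self, RingHom.id_apply]
  field_simp
  ring

theorem coverDelta_eq (D : ℕ) (g h : SL(2, ℝ)) (τ : ℍ) :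
    coverDelta D g h τ
      = rootFactor D g (h • τ) * rootFactor D h τ / rootFactor D (g * h) τ := by
  have h1 : (g 1 0 : ℂ) * ((h 0 0 : ℂ) * τ + (h 0 1 : ℂ))
      + (g 1 1 : ℂ) * ((h 1 0 : ℂ) * τ + (h 1 1 : ℂ)) = autFactor (g * h) τ := by
    simp only [autFactor, Matrix.SpecialLinearGroup.coe_mul, Matrix.mul_apply, Fin.sum_univ_two,
      Complex.ofReal_add, Complex.ofReal_mul]
    ring
  have h2 : (g 1 0 : ℂ) * (((h 0 0 : ℂ) * τ + (h 0 1 : ℂ)) / ((h 1 0 : ℂ) * τ + (h 1 1 : ℂ)))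
      + (g 1 1 : ℂ) = autFactor g (h • τ) := by
    simp only [autFactor, coe_specialLinearGroup_apply, Algebra.algebraMap_self, RingHom.id_apply]
  rw [coverDelta, h1, h2]
  rfl

theorem rootFactor_ne_zero (D : ℕ) (g : SL(2, ℝ)) (τ : ℍ) : rootFactor D g τ ≠ 0 := by
  rw [rootFactor, Ne, Complex.cpow_eq_zero_iff]
  exact fun h => autFactor_ne_zero g τ h.1

theorem rootFactor_pow (D : ℕ) [NeZero D] (g : SL(2, ℝ)) (τ : ℍ) :
    rootFactor D g τ ^ D = autFactor g τ := by
  rw [rootFactor, one_div]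
  exact Complex.cpow_nat_inv_pow _ (NeZero.ne D)

theorem continuous_rootFactor (D : ℕ) (g : SL(2, ℝ)) : Continuous (rootFactor D g) := by
  by_cases hc : g 1 0 = 0
  · have : rootFactor D g = fun _ => ((g 1 1 : ℝ) : ℂ) ^ ((1 : ℂ) / D) := by
      funext τ
      simp [rootFactor, autFactor, hc]
    rw [this]
    exact continuous_const
  · have h1 : Continuous (autFactor g) := by
      unfold autFactor
      fun_prop
    refine h1.cpow continuous_const fun τ => Or.inr ?_
    have : (autFactor g τ).im = g 1 0 * τ.im := by simp [autFactor]
    rw [this]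
    exact mul_ne_zero hc τ.im_pos.ne'

theorem coverDelta_pow (D : ℕ) [NeZero D] (g h : SL(2, ℝ)) (τ : ℍ) :
    coverDelta D g h τ ^ D = 1 := by
  rw [coverDelta_eq, div_pow, mul_pow, rootFactor_pow, rootFactor_pow, rootFactor_pow,
    autFactor_mul, div_self]
  exact mul_ne_zero (autFactor_ne_zero _ _) (autFactor_ne_zero _ _)

/-- `δ` does not depend on `τ`. -/
theorem coverDelta_const (D : ℕ) [NeZero D] (g h : SL(2, ℝ)) (τ τ' : ℍ) :
    coverDelta D g h τ = coverDelta D g h τ' := by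
  have hc : Continuous (coverDelta D g h) := by
    have : coverDelta D g h = fun τ =>
        rootFactor D g (h • τ) * rootFactor D h τ / rootFactor D (g * h) τ :=
      funext (coverDelta_eq D g h)
    rw [this]
    have hs : Continuous fun τ : ℍ => h • τ :=
      continuous_const_smul (h : GL (Fin 2) ℝ)
    exact (((continuous_rootFactor D g).comp hs).mul (continuous_rootFactor D h)).div
      (continuous_rootFactor D (g * h)) (rootFactor_ne_zero D (g * h))
  have hfin : {z : ℂ | z ^ D = 1}.Finite := by
    refine (Polynomial.nthRoots D (1 : ℂ)).toFinset.finite_toSet.subset fun z hz => ?_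
    simpa [Polynomial.mem_nthRoots (NeZero.pos D)] using hz
  exact (isPreconnected_univ (α := ℍ)).constant_of_mapsTo (T := {z : ℂ | z ^ D = 1})
    hfin.isDiscrete hc.continuousOn (fun x _ => coverDelta_pow D g h x)
    (Set.mem_univ τ) (Set.mem_univ τ')

/-- An element of the `D`-cover of `SL(2, ℝ)`: a pair `(γ, ε (cτ + d)^{1/D})` with `ε ^ D = 1`,
recorded as `(γ, ε)`. -/
@[ext]
structure DCover (D : ℕ) where
  mat : SL(2, ℝ)
  eps : rootsOfUnity D ℂ

namespace DCover

variable {D : ℕ}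

/-- The scalar `ε` as a complex number. -/
def epsC (g : DCover D) : ℂ := ((g.eps : ℂˣ) : ℂ)

/-- The function `ε (cτ + d)^{1/D}` belonging to `(γ, ε)`. -/
def fn (g : DCover D) (τ : ℍ) : ℂ := g.epsC * rootFactor D g.mat τ

theorem ext_fn {g h : DCover D} (hm : g.mat = h.mat) (τ : ℍ) (hf : g.fn τ = h.fn τ) : g = h := by
  refine DCover.ext hm (Subtype.ext (Units.ext ?_))
  unfold fn at hf
  rw [hm] at hf
  exact mul_right_cancel₀ (rootFactor_ne_zero D h.mat τ) hf

variable [NeZero D]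

/-- `δ` as a `D`-th root of unity. -/
def delta (g h : SL(2, ℝ)) : rootsOfUnity D ℂ :=
  rootsOfUnity.mkOfPowEq (coverDelta D g h UpperHalfPlane.I) (coverDelta_pow D g h _)

theorem coe_delta (g h : SL(2, ℝ)) (τ : ℍ) :
    (((delta g h : rootsOfUnity D ℂ) : ℂˣ) : ℂ) = coverDelta D g h τ :=
  (rootsOfUnity.coe_mkOfPowEq (coverDelta_pow D g h _)).trans (coverDelta_const D g h _ τ)

/-- `(γ₁, ε₁)(γ₂, ε₂) = (γ₁γ₂, ε₁ε₂δ)`. -/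
instance : Mul (DCover D) := ⟨fun g h => ⟨g.mat * h.mat, g.eps * h.eps * delta g.mat h.mat⟩⟩

instance : One (DCover D) := ⟨⟨1, 1⟩⟩

instance : Inv (DCover D) := ⟨fun g => ⟨g.mat⁻¹, g.eps⁻¹ * (delta g.mat⁻¹ g.mat)⁻¹⟩⟩

theorem mul_mat (g h : DCover D) : (g * h).mat = g.mat * h.mat := rfl

theorem one_mat : (1 : DCover D).mat = 1 := rfl

theorem inv_mat (g : DCover D) : (g⁻¹).mat = g.mat⁻¹ := rfl

theorem mul_epsC (g h : DCover D) (τ : ℍ) :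
    (g * h).epsC = g.epsC * h.epsC * coverDelta D g.mat h.mat τ := by
  rw [← coe_delta]
  rfl

theorem fn_mul (g h : DCover D) (τ : ℍ) : (g * h).fn τ = g.fn (h.mat • τ) * h.fn τ := by
  have h0 := rootFactor_ne_zero D (g.mat * h.mat) τ
  rw [fn, mul_epsC g h τ, mul_mat, coverDelta_eq, fn, fn]
  field_simp

theorem fn_one (τ : ℍ) : (1 : DCover D).fn τ = 1 := by
  have h1 : (1 : DCover D).epsC = 1 := rfl
  simp [fn, h1, one_mat, rootFactor, autFactor]

instance : Group (DCover D) where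
  mul_assoc a b c := by
    refine ext_fn (mul_assoc a.mat b.mat c.mat) UpperHalfPlane.I ?_
    simp only [fn_mul, mul_mat, mul_smul, mul_assoc]
  one_mul a := by
    refine ext_fn (one_mul a.mat) UpperHalfPlane.I ?_
    rw [fn_mul, fn_one, one_mul]
  mul_one a := by
    refine ext_fn (mul_one a.mat) UpperHalfPlane.I ?_
    rw [fn_mul, fn_one, one_mat, one_smul, mul_one]
  inv_mul_cancel a := by
    refine DCover.ext (inv_mul_cancel a.mat) ?_
    change a.eps⁻¹ * (delta a.mat⁻¹ a.mat)⁻¹ * a.eps * delta a.mat⁻¹ a.mat = 1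
    rw [mul_right_comm a.eps⁻¹, inv_mul_cancel, one_mul, inv_mul_cancel]

/-- The natural projection from the `D`-cover to `SL(2, ℝ)`. -/
def proj (D : ℕ) [NeZero D] : DCover D →* SL(2, ℝ) where
  toFun := mat
  map_one' := rfl
  map_mul' _ _ := rfl

/-- The `D`-cover of a subgroup `G` of `SL(2, ℤ)`: the preimage of `G` under the projection. -/
def cover (D : ℕ) [NeZero D] (G : Subgroup SL(2, ℤ)) : Subgroup (DCover D) :=
  (G.map (Matrix.SpecialLinearGroup.map (Int.castRingHom ℝ))).comap (proj D)

end DCover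

/-- The slash operator
`(f ∣_k (γ, ε))(τ) = ε^{-Dk} (cτ + d)^{-k} f((aτ + b)/(cτ + d))`, for `k ∈ (1/D)ℤ`. -/
def slashD {D : ℕ} (k : ℚ) (f : ℍ → ℂ) (g : DCover D) (τ : ℍ) : ℂ :=
  g.epsC ^ (-((D : ℂ) * (k : ℂ))) * autFactor g.mat τ ^ (-(k : ℂ)) * f (g.mat • τ)

/-! ### Orders -/

/-- The order at `τ ∈ ℍ` of a function on the upper half-plane. -/
def ordAt (f : ℍ → ℂ) (τ : ℍ) : WithTop ℤ := meromorphicOrderAt (fun z : ℂ => f (ofComplex z)) τ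

/-- `g(τ) = ∑_{n ∈ ℤ} a n q^{n/m}` with `q = e^{2πiτ}`, for `Im τ` large. A meromorphic function
on `ℍ` is only determined off a closed discrete set, so the identity is required off such a set. -/
def HasPuiseuxExpansion (g : ℍ → ℂ) (m : ℕ) (a : ℤ → ℂ) : Prop :=
  ∃ A : ℝ, ∀ᶠ τ : ℍ in codiscrete ℍ, A < τ.im →
    HasSum (fun n : ℤ => a n * Complex.exp (2 * Real.pi * Complex.I * ((n : ℂ) / m) * τ)) (g τ)

/-- `g` is meromorphic at `i∞`: it has an expansion in powers of `q^{1/m}`, for some `m ≥ 1`,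
with only finitely many negative exponents. -/
def MeromorphicAtImInfty (g : ℍ → ℂ) : Prop :=
  ∃ m : ℕ, 0 < m ∧ ∃ a : ℤ → ℂ, HasPuiseuxExpansion g m a ∧ ∃ N : ℤ, ∀ n < N, a n = 0

/-- `g` has (finite) order `r` at `i∞`: `r` is the least exponent of `q` that occurs in the
expansion of `g` with nonzero coefficient. -/
def HasOrdAtImInfty (g : ℍ → ℂ) (r : ℚ) : Prop :=
  ∃ m : ℕ, 0 < m ∧ ∃ a : ℤ → ℂ, HasPuiseuxExpansion g m a ∧
    ∃ n : ℤ, IsLeast {j : ℤ | a j ≠ 0} n ∧ r = (n : ℚ) / m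

theorem neBot_atImInfty_codiscrete : (atImInfty ⊓ codiscrete ℍ).NeBot := by
  rw [inf_neBot_iff]
  intro S hS T hT
  obtain ⟨A, hA⟩ := (atImInfty_mem S).mp hS
  have hne : Nontrivial ℍ := ⟨⟨UpperHalfPlane.I, (1 : ℝ) +ᵥ UpperHalfPlane.I, fun h => by
    simpa using congrArg UpperHalfPlane.re h⟩⟩
  let τ₀ : ℍ := ⟨((|A| + 1 : ℝ) : ℂ) * Complex.I, by simp; positivity⟩
  have him : τ₀.im = |A| + 1 := by
    change (((|A| + 1 : ℝ) : ℂ) * Complex.I).im = _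
    simp
  have h1 : T ∈ 𝓝[≠] τ₀ := by
    have := mem_codiscreteWithin_iff_forall_mem_nhdsNE.mp hT τ₀ (Set.mem_univ _)
    simpa using this
  have h2 : {τ : ℍ | A < τ.im} ∈ 𝓝[≠] τ₀ := by
    refine mem_nhdsWithin_of_mem_nhds ?_
    refine (isOpen_lt continuous_const UpperHalfPlane.continuous_im).mem_nhds ?_
    change A < τ₀.im
    rw [him]
    linarith [le_abs_self A]
  have h3 : (𝓝[≠] τ₀).NeBot := inferInstance
  obtain ⟨τ, hτ⟩ := h3.nonempty_of_mem (inter_mem h1 h2)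
  exact ⟨τ, hA τ hτ.2.le, hτ.1⟩

/-- If `g` has order `r` at `i∞`, then `g(τ) q^{-r}` tends to a nonzero limit. -/
theorem HasOrdAtImInfty.tendsto {g : ℍ → ℂ} {r : ℚ} (h : HasOrdAtImInfty g r) :
    ∃ c : ℂ, c ≠ 0 ∧ Tendsto (fun τ : ℍ => g τ * Complex.exp (2 * Real.pi * Complex.I * (-r) * τ))
      (atImInfty ⊓ codiscrete ℍ) (𝓝 c) := by
  obtain ⟨m, hm, a, ⟨A, hA⟩, n, hn, rfl⟩ := h
  have hnb := neBot_atImInfty_codiscrete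
  have hm' : (0 : ℝ) < m := by exact_mod_cast hm
  have hlarge : ∀ B : ℝ, ∀ᶠ τ : ℍ in atImInfty ⊓ codiscrete ℍ, B < τ.im := fun B =>
    Eventually.filter_mono inf_le_left ((atImInfty_mem _).mpr
      ⟨B + 1, fun z hz => lt_of_lt_of_le (by linarith) hz⟩)
  have hev : ∀ᶠ τ : ℍ in atImInfty ⊓ codiscrete ℍ,
      HasSum (fun j : ℤ => a j * Complex.exp (2 * Real.pi * Complex.I * (((j - n : ℤ) : ℂ) / m) * τ))
        (g τ * Complex.exp (2 * Real.pi * Complex.I * (-(((n : ℚ) / m : ℚ) : ℂ)) * τ)) := by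
    filter_upwards [hlarge A, hA.filter_mono inf_le_right] with τ h1 h2
    refine ((h2 h1).mul_right _).congr_fun ?_
    intro j
    rw [mul_assoc (a j), ← Complex.exp_add]
    congr 2
    push_cast
    ring
  have hnorm : ∀ (j : ℤ) (τ : ℍ),
      ‖a j * Complex.exp (2 * Real.pi * Complex.I * (((j - n : ℤ) : ℂ) / m) * τ)‖
        = ‖a j‖ * Real.exp (-(2 * Real.pi * ((j - n : ℤ) / m : ℝ) * τ.im)) := by
    intro j τ
    rw [norm_mul, Complex.norm_exp]
    congr 2
    have : (2 * Real.pi * Complex.I * (((j - n : ℤ) : ℂ) / m) * τ : ℂ)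
        = ((2 * Real.pi * ((j - n : ℤ) / m : ℝ) : ℝ) : ℂ) * (τ * Complex.I) := by
      push_cast
      ring
    rw [this, Complex.re_ofReal_mul]
    simp
  obtain ⟨τ₀, hτ₀⟩ := hev.exists
  refine ⟨a n, hn.1, ?_⟩
  have key : Tendsto (fun τ : ℍ => ∑' j : ℤ,
      a j * Complex.exp (2 * Real.pi * Complex.I * (((j - n : ℤ) : ℂ) / m) * τ))
      (atImInfty ⊓ codiscrete ℍ) (𝓝 (∑' j : ℤ, if j = n then a n else 0)) := by
    refine tendsto_tsum_of_dominated_convergence hτ₀.summable.norm ?_ ?_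
    · intro j
      by_cases hj : j = n
      · subst hj
        simp
      · rw [if_neg hj]
        by_cases haj : a j = 0
        · simp [haj]
        have hlt : n < j := lt_of_le_of_ne (hn.2 haj) (Ne.symm hj)
        have hpos : (0 : ℝ) < 2 * Real.pi * ((j - n : ℤ) / m : ℝ) := by
          have : (0 : ℝ) < (j - n : ℤ) := by exact_mod_cast sub_pos.mpr hlt
          positivity
        rw [tendsto_zero_iff_norm_tendsto_zero]
        simp only [hnorm]
        have him : Tendsto (fun τ : ℍ => τ.im) (atImInfty ⊓ codiscrete ℍ) atTop :=
          tendsto_comap.mono_left inf_le_left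
        simpa using (Real.tendsto_exp_neg_atTop_nhds_zero.comp
          (him.const_mul_atTop hpos)).const_mul ‖a j‖
    · filter_upwards [hlarge τ₀.im] with τ hτ j
      rw [hnorm, hnorm]
      by_cases haj : a j = 0
      · simp [haj]
      have hle : (0 : ℝ) ≤ (j - n : ℤ) := by exact_mod_cast sub_nonneg.mpr (hn.2 haj)
      gcongr
  rw [tsum_ite_eq] at key
  refine key.congr' ?_
  filter_upwards [hev] with τ hτ using hτ.tsum_eq

/-- The order at `i∞` is unique. -/
theorem HasOrdAtImInfty.unique {g : ℍ → ℂ} {r s : ℚ} (hr : HasOrdAtImInfty g r)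
    (hs : HasOrdAtImInfty g s) : r = s := by
  wlog hrs : r < s generalizing r s
  · rcases lt_trichotomy r s with h | h | h
    · exact this hr hs h
    · exact h
    · exact (this hs hr h).symm
  exfalso
  have hnb := neBot_atImInfty_codiscrete
  obtain ⟨c, hc, h1⟩ := hr.tendsto
  obtain ⟨d, -, h2⟩ := hs.tendsto
  have hpos : (0 : ℝ) < 2 * Real.pi * ((s : ℝ) - r) := by
    have : (r : ℝ) < s := by exact_mod_cast hrs
    have := Real.pi_pos
    have : (0 : ℝ) < (s : ℝ) - r := by linarith
    positivity
  have him : Tendsto (fun τ : ℍ => τ.im) (atImInfty ⊓ codiscrete ℍ) atTop :=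
    tendsto_comap.mono_left inf_le_left
  have h3 : Tendsto (fun τ : ℍ => Complex.exp (2 * Real.pi * Complex.I * ((s : ℂ) - r) * τ))
      (atImInfty ⊓ codiscrete ℍ) (𝓝 0) := by
    rw [tendsto_zero_iff_norm_tendsto_zero]
    have : ∀ τ : ℍ, ‖Complex.exp (2 * Real.pi * Complex.I * ((s : ℂ) - r) * τ)‖
        = Real.exp (-(2 * Real.pi * ((s : ℝ) - r) * τ.im)) := by
      intro τ
      rw [Complex.norm_exp]
      congr 1
      have : (2 * Real.pi * Complex.I * ((s : ℂ) - r) * τ : ℂ)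
          = ((2 * Real.pi * ((s : ℝ) - r) : ℝ) : ℂ) * (τ * Complex.I) := by
        push_cast
        ring
      rw [this, Complex.re_ofReal_mul]
      simp
    simp only [this]
    exact Real.tendsto_exp_neg_atTop_nhds_zero.comp (him.const_mul_atTop hpos)
  have h4 := h2.mul h3
  rw [mul_zero] at h4
  refine hc (tendsto_nhds_unique h1 (h4.congr fun τ => ?_))
  rw [mul_assoc, ← Complex.exp_add]
  congr 2
  ring

open Classical in
/-- The order at `i∞` (with value `0` if there is no finite order). -/
def ordAtImInfty (g : ℍ → ℂ) : ℚ :=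
  if h : ∃ r, HasOrdAtImInfty g r then h.choose else 0

/-! ### Meromorphic modular forms -/

/-- Meromorphic modular forms of weight `k` on the `D`-cover of `G` with multiplier system `χ`.
Identities between meromorphic functions are understood off closed discrete sets, so that the
values of `f` at its poles play no role. -/
structure IsMeromorphicModularForm (D : ℕ) [NeZero D] (k : ℚ) (G : Subgroup SL(2, ℤ))
    (χ : DCover.cover D G →* ℂˣ) (f : ℍ → ℂ) : Prop where
  meromorphic : ∀ τ : ℍ, MeromorphicAt (fun z : ℂ => f (ofComplex z)) τ
  slash_eq : ∀ γ : DCover.cover D G,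
    slashD k f (γ : DCover D) =ᶠ[codiscrete ℍ] fun τ => ((χ γ : ℂˣ) : ℂ) * f τ
  meromorphic_cusps : ∀ γ ∈ DCover.cover D (⊤ : Subgroup SL(2, ℤ)),
    MeromorphicAtImInfty (slashD k f γ)

/-! ### The action of `PSL(2, ℤ)` on the upper half-plane -/

theorem center_smul (g : SL(2, ℤ)) (hg : g ∈ Subgroup.center SL(2, ℤ)) (τ : ℍ) : g • τ = τ := by
  obtain ⟨r, hr, hg⟩ := Matrix.SpecialLinearGroup.mem_center_iff.mp hg
  have hr' : r = 1 ∨ r = -1 := by simpa using hr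
  rcases hr' with rfl | rfl
  · have : g = 1 := Subtype.ext (by rw [← hg]; simp)
    rw [this, one_smul]
  · have : g = -1 := Subtype.ext (by rw [← hg]; simp)
    rw [this, ModularGroup.SL_neg_smul, one_smul]

/-- The action of `PSL(2, ℤ)` on `ℍ` induced by that of `SL(2, ℤ)`. -/
instance pslAction : MulAction PSL(2, ℤ) ℍ :=
  MulAction.compHom ℍ (QuotientGroup.lift (Subgroup.center SL(2, ℤ))
    (MulAction.toPermHom SL(2, ℤ) ℍ)
    (fun g hg => Equiv.ext fun τ => center_smul g hg τ))

theorem psl_mk_smul (g : SL(2, ℤ)) (τ : ℍ) : (QuotientGroup.mk g : PSL(2, ℤ)) • τ = g • τ := rfl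

/-- The image of `G` in `PSL(2, ℤ)`. -/
def barSubgroup (G : Subgroup SL(2, ℤ)) : Subgroup PSL(2, ℤ) :=
  G.map (QuotientGroup.mk' (Subgroup.center SL(2, ℤ)))

/-- The set `Ḡ \ PSL(2, ℤ)` of right cosets. -/
abbrev CosetSpace (G : Subgroup SL(2, ℤ)) : Type :=
  Quotient (QuotientGroup.rightRel (barSubgroup G))

/-- The coset `Ḡ γ̄` of (the image of) `γ ∈ SL(2, ℤ)`. -/
def cosetMk (G : Subgroup SL(2, ℤ)) (γ : SL(2, ℤ)) : CosetSpace G :=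
  Quotient.mk _ (QuotientGroup.mk γ : PSL(2, ℤ))

/-- The set `Ḡ \ ℍ` of orbits. -/
abbrev OrbitSpace (G : Subgroup SL(2, ℤ)) : Type :=
  MulAction.orbitRel.Quotient (barSubgroup G) ℍ

/-- The orbit `Ḡ τ`. -/
def orbitMk (G : Subgroup SL(2, ℤ)) (τ : ℍ) : OrbitSpace G := Quotient.mk _ τ

/-- The element `(γ, ε)` of the `D`-cover of `SL(2, ℤ)`. -/
def DCover.ofInt {D : ℕ} (γ : SL(2, ℤ)) (ε : rootsOfUnity D ℂ) : DCover D :=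
  ⟨Matrix.SpecialLinearGroup.map (Int.castRingHom ℝ) γ, ε⟩

end

open scoped Manifold

noncomputable section

namespace Valence

/-! ### The modular invariant separates orbits -/

section Separation

open ModularForm EisensteinSeries PeriodPair

/-! Everything is reduced to weight zero and level one, where the modular invariant j replaces the
usual contour integral. Write k = m/D and let N be the index of the kernel of χ. The function ψ =
f^(12DN) Δ^(-mN) is invariant under Ḡ: the D-th power removes ε and the choice of root, the N-th
power removes χ, and the weights cancel. Since Δ has no zeros in ℍ and a simple zero at the cusp,
the orders of ψ are 12DN times those of f, lowered by mN at each cusp. The product of the translates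
of ψ over Ḡ\PSL(2, ℤ) is invariant under PSL(2, ℤ), so it suffices to show that an invariant h has
degree zero (`levelOne_valence`) and to regroup orbits (`finsum_orbit_subgroup`).

For such h, suitable powers of the functions j - j(y) cancel all zeros and poles of a power of h in
ℍ. What remains, or its inverse, is a level-one form of weight zero, hence constant, so its order at
the cusp vanishes. As j has a simple pole there, this is the degree formula with weights 1/e(y),
where e is the ramification index of j (`levelOne_valence_jRam`). It requires that j separate orbits
(`exists_smul_eq_of_jInv_eq`): j determines (E₄, E₆) up to scaling, hence all level-one forms, hence
the Eisenstein sums of the lattice, hence its ℘-function and the lattice itself.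

It remains to identify e with the order of the stabilizer. The degree formula for (j')^6/Δ gives ∑
6(1 - 1/e) = 7. The derivatives of the elliptic elements force e(i) ≥ 2 and e(ρ) ≥ 3, which already
account for 3 + 4 = 7, so these are equalities and e = 1 on all other orbits (`jRam_eq_ite`). -/

/-- The modular invariant `j = E₄³ / Δ`. -/
def jInv (τ : ℍ) : ℂ := E₄ τ ^ 3 / discriminant τ

/-! ### Level-one forms are controlled by E₄ and E₆. -/

theorem exists_weight_decomposition {k : ℤ} (hk : 4 ≤ k) (hk2 : Even k) :
    ∃ a b : ℕ, (a : ℤ) * 4 + (b : ℤ) * 6 = k := by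
  obtain ⟨m, rfl⟩ := hk2
  rcases Int.even_or_odd m with ⟨r, hr⟩ | ⟨r, hr⟩
  · exact ⟨r.toNat, 0, by omega⟩
  · exact ⟨(r - 1).toNat, 1, by omega⟩

theorem exists_modularForm_constantCoeff_one {k : ℤ} (hk : 4 ≤ k) (hk2 : Even k) :
    ∃ (a b : ℕ) (F : ModularForm 𝒮ℒ k), (a : ℤ) * 4 + (b : ℤ) * 6 = k ∧
      (∀ τ, F τ = E₄ τ ^ a * E₆ τ ^ b) ∧ (qExpansion 1 F).coeff 0 = 1 := by
  obtain ⟨a, b, hab⟩ := exists_weight_decomposition hk hk2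
  refine ⟨a, b, ModularForm.mcast hab ((E₄.pow a).mul (E₆.pow b)), hab, fun τ => ?_, ?_⟩
  · rw [ModularForm.mcast_apply, ModularForm.coe_mul, ModularForm.coe_pow, ModularForm.coe_pow]
    rfl
  · rw [ModularForm.qExpansion_mcast, ModularForm.qExpansion_mul one_pos one_mem_strictPeriods_SL,
      ModularForm.qExpansion_pow one_pos one_mem_strictPeriods_SL,
      ModularForm.qExpansion_pow one_pos one_mem_strictPeriods_SL]
    have h4 := E_qExpansion_coeff_zero (k := 4) (by norm_num) ⟨2, rfl⟩
    have h6 := E_qExpansion_coeff_zero (k := 6) (by norm_num) ⟨3, rfl⟩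
    rw [PowerSeries.coeff_zero_eq_constantCoeff] at h4 h6 ⊢
    rw [map_mul, map_pow, map_pow, h4, h6, one_pow, one_pow, one_mul]

/-- Proportional values of `E₄` and `E₆` give proportional values of all modular forms. -/
theorem modularForm_eq_of_E₄_E₆ {τ₁ τ₂ : ℍ} {l : ℂ} (hl : l ≠ 0)
    (h4 : E₄ τ₁ = l ^ 4 * E₄ τ₂) (h6 : E₆ τ₁ = l ^ 6 * E₆ τ₂) (n : ℕ) :
    ∀ k : ℤ, k < n → ∀ f : ModularForm 𝒮ℒ k, f τ₁ = l ^ k * f τ₂ := by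
  have hΔ : discriminant τ₁ = l ^ 12 * discriminant τ₂ := by
    rw [discriminant_eq_E₄_cube_sub_E₆_sq, discriminant_eq_E₄_cube_sub_E₆_sq, h4, h6]
    ring
  -- Strong induction on the weight; the bound k < n starts with the negative weights, where every
  -- form is zero.
  induction n with
  | zero =>
    intro k hk f
    have := ModularFormClass.levelOne_neg_weight_eq_zero (by simpa using hk) f
    simp [this]
  | succ n ih =>
    intro k hk f
    rcases Int.even_or_odd k with he | ho
    · rcases lt_or_ge k 4 with h | h
      · rcases lt_or_ge k 0 with h0 | h0
        · have := ModularFormClass.levelOne_neg_weight_eq_zero h0 f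
          simp [this]
        · have : k = 0 ∨ k = 2 := by
            obtain ⟨m, rfl⟩ := he
            omega
          rcases this with rfl | rfl
          · obtain ⟨c, hc⟩ := ModularFormClass.levelOne_weight_zero_const f
            simp [hc]
          · have := rank_zero_iff_forall_zero.mp levelOne_weight_two_rank_zero f
            simp [this]
      · obtain ⟨a, b, F, hab, hF, hF1⟩ := exists_modularForm_constantCoeff_one h he
        -- Subtracting a multiple of E₄^a E₆^b kills the constant term; the resulting cusp form is Δ
        -- times a form of weight k - 12.
        have hc := sub_smul_isCuspForm f F hF1
        rw [isCuspForm_iff_coeffZero_eq_zero] at hc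
        set c := (qExpansion 1 f).coeff 0
        set g := CuspForm.discriminantEquiv (toCuspForm (f - c • F) hc)
        have hg : ∀ τ, f τ = c * F τ + discriminant τ * g τ := by
          intro τ
          have := discriminant_mul_discriminantEquiv_apply (toCuspForm (f - c • F) hc) τ
          rw [toCuspForm_apply] at this
          rw [this]
          change f τ = c * F τ + (f τ - c * F τ)
          ring
        have hlF : F τ₁ = l ^ k * F τ₂ := by
          rw [hF, hF, h4, h6, ← hab, zpow_add₀ hl, _root_.zpow_mul, _root_.zpow_mul, mul_pow, mul_pow]
          simp only [zpow_natCast]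
          norm_cast
          rw [← pow_mul, ← pow_mul, ← pow_mul, ← pow_mul, mul_comm 4 a, mul_comm 6 b]
          ring
        have hlg := ih (k - 12) (by push_cast at hk; omega) g
        rw [hg τ₁, hg τ₂, hlF, hΔ, hlg, zpow_sub₀ hl]
        have : l ^ (12 : ℤ) = l ^ 12 := by norm_cast
        rw [this]
        have : l ^ 12 ≠ 0 := pow_ne_zero _ hl
        field_simp
    · have := ModularForm.levelOne_odd_weight_eq_zero ho f
      simp [this]

/-! ### Recovering a lattice from its Eisenstein sums. -/

/-- The period pair `(τ / l, 1 / l)`. -/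
def scaledPair (τ : ℍ) (l : ℂ) (hl : l ≠ 0) : PeriodPair where
  ω₁ := τ / l
  ω₂ := 1 / l
  indep := by
    rw [LinearIndependent.pair_iff]
    intro s t h
    have h' : (s : ℂ) * τ + t = 0 := by
      have : (s : ℂ) * (τ / l) + t * (1 / l) = 0 := by simpa using h
      field_simp at this
      simpa using this
    have him := congrArg Complex.im h'
    have hre := congrArg Complex.re h'
    simp at him hre
    have hs : s = 0 := him.resolve_right τ.im_ne_zero
    subst hs
    simpa using hre

/-- The Eisenstein sum is homogeneous of degree -n in the lattice, and the zeta factor passes from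
coprime pairs to all pairs. -/
theorem scaledPair_G (τ : ℍ) (l : ℂ) (hl : l ≠ 0) {n : ℕ} (hn : 3 ≤ n) :
    (scaledPair τ l hl).G n = l ^ n * (2 * riemannZeta n * E hn τ) := by
  have h1 := tsum_eisSummand_eq_riemannZeta_mul_eisensteinSeries hn τ
  have hE : E hn τ = (1 / 2 : ℂ) * eisensteinSeries (N := 1) 0 n τ := rfl
  rw [hE]
  have h2 : (2 : ℂ) * riemannZeta n * (1 / 2 * eisensteinSeries (N := 1) 0 n τ)
      = riemannZeta n * eisensteinSeries (N := 1) 0 n τ := by ring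
  rw [h2, ← h1, ← (finTwoArrowEquiv ℤ).symm.tsum_eq, ← tsum_mul_left, PeriodPair.G,
    ← (scaledPair τ l hl).latticeEquivProd.symm.toEquiv.tsum_eq]
  refine tsum_congr fun x => ?_
  have := (scaledPair τ l hl).latticeEquiv_symm_apply x
  change (((scaledPair τ l hl).latticeEquivProd.symm x).1 ^ n)⁻¹ = _
  rw [this]
  simp only [scaledPair, eisSummand, finTwoArrowEquiv_symm_apply]
  have : (x.1 : ℂ) * (τ / l) + x.2 * (1 / l) = (x.1 * τ + x.2) / l := by ring
  rw [this, div_pow, inv_div]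
  simp [_root_.zpow_neg, div_eq_mul_inv]

/-- A lattice in `ℂ` is determined by its Eisenstein sums. -/
theorem lattice_le_of_G_eq {L L' : PeriodPair} (h : ∀ n, 3 ≤ n → L.G n = L'.G n) :
    L.lattice ≤ L'.lattice := by
  have hser : ∀ M : PeriodPair, M.weierstrassPExcept 0 0 = 0 := by
    intro M
    have : ∀ l : M.lattice, (if (l : ℂ) = 0 then (0 : ℂ) else (1 / (0 - l) ^ 2 - 1 / l ^ 2)) = 0 := by
      intro l
      split_ifs <;> simp
    rw [PeriodPair.weierstrassPExcept]
    simp only [this, tsum_zero]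
  -- The Eisenstein sums are, up to the factors i + 1, the Taylor coefficients at 0 of ℘(z) - 1/z².
  have hnear : L.weierstrassPExcept 0 =ᶠ[𝓝 0] L'.weierstrassPExcept 0 := by
    have h1 := L.hasFPowerSeriesAt_weierstrassPExcept 0
    have h2 := L'.hasFPowerSeriesAt_weierstrassPExcept 0
    rw [hser, sumInvPow_zero] at h1 h2
    have h3 : ∀ i : ℕ, (if i = 0 then (0 : ℂ) else (i + 1) * L.G (i + 2))
        = if i = 0 then (0 : ℂ) else (i + 1) * L'.G (i + 2) := by
      intro i
      split_ifs with hi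
      · rfl
      · rw [h (i + 2) (by omega)]
    simp only [h3] at h1
    have h4 := h1.sub h2
    rw [sub_self] at h4
    filter_upwards [h4.eventually_eq_zero] with z hz
    simpa [sub_eq_zero] using hz
  set S : Set ℂ := (L.lattice : Set ℂ) ∪ L'.lattice
  have hcount : ∀ M : PeriodPair, (M.lattice : Set ℂ).Countable := by
    intro M
    have : Countable M.lattice := M.latticeEquivProd.toEquiv.countable_iff.mpr inferInstance
    exact Set.to_countable _
  have hScount : (S \ {0}).Countable := ((hcount L).union (hcount L')).mono Set.sdiff_subset
  -- The complement of a countable set in ℂ is connected, so the identity spreads from 0. The point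
  -- 0 is kept because the pole there has been removed.
  have hconn : IsPreconnected (S \ {0})ᶜ :=
    (hScount.isConnected_compl_of_one_lt_rank (by simp)).isPreconnected
  have hsub : ∀ M : PeriodPair, (M.lattice : Set ℂ) ⊆ S → (S \ {0})ᶜ ⊆ ((M.lattice : Set ℂ) \ {0})ᶜ :=
    fun M hM => Set.compl_subset_compl.mpr (Set.sdiff_subset_sdiff_left hM)
  have heq : Set.EqOn (L.weierstrassPExcept 0) (L'.weierstrassPExcept 0) (S \ {0})ᶜ :=
    ((L.analyticOnNhd_weierstrassPExcept 0).mono (hsub L Set.subset_union_left)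
      ).eqOn_of_preconnected_of_eventuallyEq
      ((L'.analyticOnNhd_weierstrassPExcept 0).mono (hsub L' Set.subset_union_right)) hconn
      (by simp) hnear
  intro x hx
  by_contra hx'
  have hS : IsClosed S := L.isClosed_lattice.union L'.isClosed_lattice
  have hdisc : ∀ᶠ z in 𝓝[≠] x, z ∉ S := by
    have h1 : ∀ᶠ z in 𝓝[≠] x, z ∉ (L'.lattice : Set ℂ) :=
      nhdsWithin_le_nhds (L'.isClosed_lattice.isOpen_compl.mem_nhds hx')
    have h2 : ∀ᶠ z in 𝓝[≠] x, z ∉ (L.lattice : Set ℂ) \ {x} :=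
      nhdsWithin_le_nhds (L.compl_lattice_sdiff_singleton_mem_nhds x)
    filter_upwards [h1, h2, self_mem_nhdsWithin] with z hz1 hz2 hz3
    rintro (h | h)
    · exact hz2 ⟨h, hz3⟩
    · exact hz1 h
  have hzero : ∀ (M : PeriodPair) (z : ℂ), M.weierstrassPExcept 0 z = M.weierstrassP z - 1 / z ^ 2 := by
    intro M z
    have := M.weierstrassPExcept_def 0 z
    simp only [ZeroMemClass.coe_zero] at this
    rw [this]
    simp [sub_eq_add_neg]
  have hcong : L.weierstrassP =ᶠ[𝓝[≠] x] L'.weierstrassP := by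
    filter_upwards [hdisc] with z hz
    have := heq (show z ∈ (S \ {0})ᶜ from fun h => hz h.1)
    rw [hzero, hzero] at this
    simpa using this
  -- A point of the first lattice only would be a double pole of one ℘-function and a regular point
  -- of the other.
  have h1 := L.order_weierstrassP x hx
  rw [meromorphicOrderAt_congr hcong] at h1
  have h2 := (L'.analyticOnNhd_weierstrassP x hx').meromorphicOrderAt_nonneg
  rw [h1] at h2
  exact absurd h2 (by decide)

/-- Two bases of one lattice differ by an integral matrix of determinant ±1; the sign is + because
both τ₁ and τ₂ lie in the upper half-plane. -/
theorem exists_smul_eq_of_lattice_eq {τ₁ τ₂ : ℍ} {l : ℂ} (hl : l ≠ 0)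
    (h : (scaledPair τ₁ 1 one_ne_zero).lattice = (scaledPair τ₂ l hl).lattice) :
    ∃ γ : SL(2, ℤ), γ • τ₂ = τ₁ := by
  have hmem : ∀ x : ℂ, (∃ m n : ℤ, m * (τ₁ / 1 : ℂ) + n * (1 / 1) = x)
      ↔ ∃ m n : ℤ, m * (τ₂ / l : ℂ) + n * (1 / l) = x := fun x =>
    (PeriodPair.mem_lattice (L := scaledPair τ₁ 1 one_ne_zero)).symm.trans
      ((iff_of_eq (congrArg (x ∈ ·) h)).trans (PeriodPair.mem_lattice (L := scaledPair τ₂ l hl)))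
  obtain ⟨a, b, hab⟩ := (hmem τ₁).mp ⟨1, 0, by simp⟩
  obtain ⟨c, d, hcd⟩ := (hmem 1).mp ⟨0, 1, by simp⟩
  obtain ⟨a', b', hab'⟩ := (hmem (τ₂ / l)).mpr ⟨1, 0, by simp⟩
  obtain ⟨c', d', hcd'⟩ := (hmem (1 / l)).mpr ⟨0, 1, by simp⟩
  rw [← hab', ← hcd'] at hab hcd
  have key : ∀ p q : ℤ, (p : ℂ) * τ₁ + q = 0 → p = 0 ∧ q = 0 := by
    intro p q hpq
    have him := congrArg Complex.im hpq
    have hre := congrArg Complex.re hpq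
    simp at him hre
    have hs : p = 0 := him.resolve_right τ₁.im_ne_zero
    subst hs
    exact ⟨rfl, by simpa using hre⟩
  obtain ⟨e1, e2⟩ := key (a * a' + b * c' - 1) (a * b' + b * d') (by
    push_cast
    linear_combination hab)
  obtain ⟨e3, e4⟩ := key (c * a' + d * c') (c * b' + d * d' - 1) (by
    push_cast
    linear_combination hcd)
  have hdet : (a * d - b * c) * (a' * d' - b' * c') = 1 := by
    linear_combination (c * b' + d * d') * e1 + e4 - (c * a' + d * c') * e2
  have hden : (c : ℂ) * τ₂ + d = l := by
    have : (c : ℂ) * (τ₂ / l) + d * (1 / l) = 1 := by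
      rw [← hab', ← hcd']
      exact hcd
    field_simp at this
    exact this
  have hnum : (a : ℂ) * τ₂ + b = τ₁ * l := by
    have : (a : ℂ) * (τ₂ / l) + b * (1 / l) = τ₁ := by
      rw [← hab', ← hcd']
      exact hab
    field_simp at this
    rw [this, mul_comm]
  have hpos : 0 < a * d - b * c := by
    have h1 : (((a : ℂ) * τ₂ + b) * (starRingEnd ℂ) ((c : ℂ) * τ₂ + d)).im
        = (a * d - b * c) * τ₂.im := by
      simp
      ring
    have h2 : (((a : ℂ) * τ₂ + b) * (starRingEnd ℂ) ((c : ℂ) * τ₂ + d)).im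
        = τ₁.im * Complex.normSq l := by
      rw [hden, hnum, mul_assoc, Complex.mul_conj]
      simp
    have h3 : (0 : ℝ) < τ₁.im * Complex.normSq l :=
      mul_pos τ₁.im_pos (Complex.normSq_pos.mpr hl)
    rw [← h2, h1] at h3
    have := pos_of_mul_pos_left h3 τ₂.im_pos.le
    exact_mod_cast this
  have hone : a * d - b * c = 1 := by
    rcases Int.isUnit_iff.mp (IsUnit.of_mul_eq_one _ hdet) with h | h
    · exact h
    · omega
  let γ : SL(2, ℤ) := ⟨!![a, b; c, d], by rw [Matrix.det_fin_two_of]; exact hone⟩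
  refine ⟨γ, UpperHalfPlane.ext ?_⟩
  rw [UpperHalfPlane.coe_specialLinearGroup_apply]
  simp [γ, hnum, hden, hl]

/-- Equality of j says that E₄³ and E₆² are in the same ratio at both points. The scalar l is a root
of the ratio that makes sense: a sixth root if E₄ vanishes, a fourth root if E₆ does. -/
theorem exists_E₄_E₆_scaling {τ₁ τ₂ : ℍ} (h : jInv τ₁ = jInv τ₂) :
    ∃ l : ℂ, l ≠ 0 ∧ E₄ τ₁ = l ^ 4 * E₄ τ₂ ∧ E₆ τ₁ = l ^ 6 * E₆ τ₂ := by
  have hd1 := discriminant_ne_zero τ₁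
  have hd2 := discriminant_ne_zero τ₂
  have hj : E₄ τ₁ ^ 3 * discriminant τ₂ = E₄ τ₂ ^ 3 * discriminant τ₁ := by
    rwa [jInv, jInv, div_eq_div_iff hd1 hd2] at h
  have e1 := discriminant_eq_E₄_cube_sub_E₆_sq τ₁
  have e2 := discriminant_eq_E₄_cube_sub_E₆_sq τ₂
  have hj' : E₄ τ₁ ^ 3 * E₆ τ₂ ^ 2 = E₄ τ₂ ^ 3 * E₆ τ₁ ^ 2 := by
    rw [e1, e2] at hj
    linear_combination -1728 * hj
  have hz : ∀ τ : ℍ, E₄ τ = 0 → E₆ τ ≠ 0 := fun τ h4 h6 => by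
    apply discriminant_ne_zero τ
    rw [discriminant_eq_E₄_cube_sub_E₆_sq, h4, h6]
    simp
  by_cases h4 : E₄ τ₂ = 0
  · have h4' : E₄ τ₁ = 0 := by
      rw [h4] at hj
      simpa [hd2] using hj
    have h6 := hz _ h4
    have h6' := hz _ h4'
    obtain ⟨l, hl⟩ := IsAlgClosed.exists_pow_nat_eq (E₆ τ₁ / E₆ τ₂) (n := 6) (by norm_num)
    refine ⟨l, ?_, by rw [h4, h4', mul_zero], by rw [hl]; field_simp⟩
    rintro rfl
    rw [zero_pow (by norm_num)] at hl
    exact div_ne_zero h6' h6 hl.symm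
  · have h4' : E₄ τ₁ ≠ 0 := fun h4' => by
      rw [h4'] at hj
      simp [hd1, h4] at hj
    by_cases h6 : E₆ τ₂ = 0
    · have h6' : E₆ τ₁ = 0 := by
        rw [h6] at hj'
        simpa [h4] using hj'
      obtain ⟨l, hl⟩ := IsAlgClosed.exists_pow_nat_eq (E₄ τ₁ / E₄ τ₂) (n := 4) (by norm_num)
      refine ⟨l, ?_, by rw [hl]; field_simp, by rw [h6, h6', mul_zero]⟩
      rintro rfl
      rw [zero_pow (by norm_num)] at hl
      exact div_ne_zero h4' h4 hl.symm
    · have h6' : E₆ τ₁ ≠ 0 := fun h6' => by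
        rw [h6'] at hj'
        simp [h4', h6] at hj'
      obtain ⟨l, hl⟩ := IsAlgClosed.exists_pow_nat_eq
        ((E₆ τ₁ / E₆ τ₂) / (E₄ τ₁ / E₄ τ₂)) (n := 2) (by norm_num)
      refine ⟨l, ?_, ?_, ?_⟩
      · rintro rfl
        rw [zero_pow (by norm_num)] at hl
        exact div_ne_zero (div_ne_zero h6' h6) (div_ne_zero h4' h4) hl.symm
      · rw [show l ^ 4 = (l ^ 2) ^ 2 by ring, hl]
        field_simp
        linear_combination hj'
      · rw [show l ^ 6 = (l ^ 2) ^ 3 by ring, hl]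
        field_simp
        linear_combination hj'

/-- The modular invariant separates the orbits of `SL(2, ℤ)`. -/
theorem exists_smul_eq_of_jInv_eq {τ₁ τ₂ : ℍ} (h : jInv τ₁ = jInv τ₂) :
    ∃ γ : SL(2, ℤ), γ • τ₂ = τ₁ := by
  obtain ⟨l, hl, h4, h6⟩ := exists_E₄_E₆_scaling h
  have hG : ∀ n, 3 ≤ n → (scaledPair τ₁ 1 one_ne_zero).G n = (scaledPair τ₂ l hl).G n := by
    intro n hn
    have := modularForm_eq_of_E₄_E₆ hl h4 h6 (n + 1) n (by simp) (E hn)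
    rw [zpow_natCast] at this
    rw [scaledPair_G _ _ _ hn, scaledPair_G _ _ _ hn, this]
    ring
  exact exists_smul_eq_of_lattice_eq hl
    (le_antisymm (lattice_le_of_G_eq hG) (lattice_le_of_G_eq fun n hn => (hG n hn).symm))

end Separation

/-! ### Meromorphic functions on the upper half-plane -/

section Orders

/-- Meromorphic functions on the upper half-plane. -/
def IsMeromorphic (f : ℍ → ℂ) : Prop := ∀ τ : ℍ, MeromorphicAt (fun z : ℂ => f (ofComplex z)) τ

theorem eventually_nhdsNE_coe_iff {P : ℍ → Prop} {τ : ℍ} :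
    (∀ᶠ z : ℂ in 𝓝[≠] (τ : ℂ), P (ofComplex z)) ↔ ∀ᶠ τ' in 𝓝[≠] τ, P τ' := by
  have h := isOpenEmbedding_coe.map_nhdsWithin_preimage_eq {(τ : ℂ)}ᶜ τ
  have h1 : (fun τ' : ℍ => (τ' : ℂ)) ⁻¹' {(τ : ℂ)}ᶜ = {τ}ᶜ := by
    ext τ'
    simp
  rw [h1] at h
  rw [← h, eventually_map]
  simp only [ofComplex_apply]

theorem eventually_codiscrete_iff {P : ℍ → Prop} :
    (∀ᶠ τ in codiscrete ℍ, P τ) ↔ ∀ τ, ∀ᶠ τ' in 𝓝[≠] τ, P τ' := by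
  rw [Filter.Eventually, codiscrete, mem_codiscreteWithin_iff_forall_mem_nhdsNE]
  simp [Filter.Eventually]

theorem eventually_codiscrete_smul {P : ℍ → Prop} (h : ∀ᶠ τ in codiscrete ℍ, P τ) (γ : SL(2, ℤ)) :
    ∀ᶠ τ in codiscrete ℍ, P (γ • τ) := by
  rw [eventually_codiscrete_iff] at h ⊢
  intro τ
  have hγ := (Homeomorph.smul (γ : GL (Fin 2) ℝ)).map_punctured_nhds_eq τ
  have := h (γ • τ)
  rw [show γ • τ = Homeomorph.smul (γ : GL (Fin 2) ℝ) τ from rfl, ← hγ, eventually_map] at this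
  exact this

theorem ordAt_congr {f g : ℍ → ℂ} (h : f =ᶠ[codiscrete ℍ] g) (τ : ℍ) : ordAt f τ = ordAt g τ :=
  meromorphicOrderAt_congr
    (eventually_nhdsNE_coe_iff (P := fun τ => f τ = g τ) |>.mpr (eventually_codiscrete_iff.mp h τ))

theorem ordAt_eq_top_iff {f : ℍ → ℂ} {τ : ℍ} : ordAt f τ = ⊤ ↔ ∀ᶠ τ' in 𝓝[≠] τ, f τ' = 0 :=
  meromorphicOrderAt_eq_top_iff.trans (eventually_nhdsNE_coe_iff (P := fun τ => f τ = 0))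

theorem isPreconnected_upperHalfPlaneSet : IsPreconnected upperHalfPlaneSet :=
  (convex_halfSpace_im_gt 0).isPreconnected

theorem IsMeromorphic.meromorphicOn {f : ℍ → ℂ} (hf : IsMeromorphic f) :
    MeromorphicOn (fun z : ℂ => f (ofComplex z)) upperHalfPlaneSet := fun z hz => hf ⟨z, hz⟩

theorem IsMeromorphic.ordAt_ne_top {f : ℍ → ℂ} (hf : IsMeromorphic f) {τ : ℍ}
    (h : ordAt f τ ≠ ⊤) (τ' : ℍ) : ordAt f τ' ≠ ⊤ :=
  hf.meromorphicOn.meromorphicOrderAt_ne_top_of_isPreconnected isPreconnected_upperHalfPlaneSet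
    τ.im_pos τ'.im_pos h

theorem IsMeromorphic.ordAt_ne_top_of_not_eventually_zero {f : ℍ → ℂ} (hf : IsMeromorphic f)
    (h : ¬ f =ᶠ[codiscrete ℍ] 0) (τ : ℍ) : ordAt f τ ≠ ⊤ := by
  intro hτ
  refine h (eventually_codiscrete_iff.mpr fun τ' => ordAt_eq_top_iff.mp ?_)
  by_contra hne
  exact hf.ordAt_ne_top hne τ hτ

theorem IsMeromorphic.mul {f g : ℍ → ℂ} (hf : IsMeromorphic f) (hg : IsMeromorphic g) :
    IsMeromorphic (fun τ => f τ * g τ) := fun τ => (hf τ).mul (hg τ)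

theorem IsMeromorphic.pow {f : ℍ → ℂ} (hf : IsMeromorphic f) (n : ℕ) :
    IsMeromorphic (fun τ => f τ ^ n) := fun τ => (hf τ).pow n

theorem IsMeromorphic.zpow {f : ℍ → ℂ} (hf : IsMeromorphic f) (n : ℤ) :
    IsMeromorphic (fun τ => f τ ^ n) := fun τ => (hf τ).zpow n

theorem IsMeromorphic.inv {f : ℍ → ℂ} (hf : IsMeromorphic f) :
    IsMeromorphic (fun τ => (f τ)⁻¹) := fun τ => (hf τ).inv

theorem IsMeromorphic.prod {ι : Type*} {s : Finset ι} {f : ι → ℍ → ℂ}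
    (hf : ∀ i ∈ s, IsMeromorphic (f i)) : IsMeromorphic (fun τ => ∏ i ∈ s, f i τ) :=
  fun τ => MeromorphicAt.fun_prod fun i hi => hf i hi τ

theorem ordAt_mul {f g : ℍ → ℂ} (hf : IsMeromorphic f) (hg : IsMeromorphic g) (τ : ℍ) :
    ordAt (fun τ => f τ * g τ) τ = ordAt f τ + ordAt g τ :=
  fun_meromorphicOrderAt_mul (hf τ) (hg τ)

theorem ordAt_pow {f : ℍ → ℂ} (hf : IsMeromorphic f) (n : ℕ) (τ : ℍ) :
    ordAt (fun τ => f τ ^ n) τ = n * ordAt f τ :=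
  fun_meromorphicOrderAt_pow (hf τ)

theorem ordAt_zpow {f : ℍ → ℂ} (hf : IsMeromorphic f) (n : ℤ) (τ : ℍ) :
    ordAt (fun τ => f τ ^ n) τ = n * ordAt f τ :=
  fun_meromorphicOrderAt_zpow (hf τ)

theorem ordAt_inv {f : ℍ → ℂ} (τ : ℍ) : ordAt (fun τ => (f τ)⁻¹) τ = -ordAt f τ :=
  fun_meromorphicOrderAt_inv

theorem ordAt_prod {ι : Type*} {s : Finset ι} {f : ι → ℍ → ℂ}
    (hf : ∀ i ∈ s, IsMeromorphic (f i)) (τ : ℍ) :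
    ordAt (fun τ => ∏ i ∈ s, f i τ) τ = ∑ i ∈ s, ordAt (f i) τ :=
  meromorphicOrderAt_fun_prod fun i hi => hf i hi τ

theorem analyticAt_of_mdifferentiable {f : ℍ → ℂ} (hf : MDiff f) (τ : ℍ) :
    AnalyticAt ℂ (fun z : ℂ => f (ofComplex z)) τ :=
  (UpperHalfPlane.mdifferentiable_iff.mp hf).analyticAt (isOpen_upperHalfPlaneSet.mem_nhds τ.im_pos)

theorem isMeromorphic_of_mdifferentiable {f : ℍ → ℂ} (hf : MDiff f) : IsMeromorphic f :=
  fun τ => (analyticAt_of_mdifferentiable hf τ).meromorphicAt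

theorem ordAt_eq_zero_of_mdifferentiable {f : ℍ → ℂ} (hf : MDiff f) {τ : ℍ} (h0 : f τ ≠ 0) :
    ordAt f τ = 0 :=
  (analyticAt_of_mdifferentiable hf τ).meromorphicNFAt.meromorphicOrderAt_eq_zero_iff.mpr
    (by simpa using h0)

theorem hasStrictDerivAt_smul_int (γ : SL(2, ℤ)) (τ : ℍ) :
    HasStrictDerivAt (fun w : ℂ => ((γ • ofComplex w : ℍ) : ℂ)) (1 / denom γ τ ^ 2) τ := by
  have hdet : (γ : GL (Fin 2) ℝ).val.det = 1 := by
    rw [← Matrix.GeneralLinearGroup.val_det_apply]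
    simp
  have := hasStrictDerivAt_smul (g := (γ : GL (Fin 2) ℝ)) (by rw [hdet]; exact one_pos) τ
  rwa [hdet, Complex.ofReal_one] at this

theorem analyticAt_smul_int (γ : SL(2, ℤ)) (τ : ℍ) :
    AnalyticAt ℂ (fun w : ℂ => ((γ • ofComplex w : ℍ) : ℂ)) τ := by
  refine DifferentiableOn.analyticAt (s := upperHalfPlaneSet) (fun z hz => ?_)
    (isOpen_upperHalfPlaneSet.mem_nhds τ.im_pos)
  exact (hasStrictDerivAt_smul_int γ ⟨z, hz⟩).hasDerivAt.differentiableAt.differentiableWithinAt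

theorem deriv_smul_int_ne_zero (γ : SL(2, ℤ)) (τ : ℍ) :
    deriv (fun w : ℂ => ((γ • ofComplex w : ℍ) : ℂ)) τ ≠ 0 := by
  rw [(hasStrictDerivAt_smul_int γ τ).hasDerivAt.deriv]
  exact one_div_ne_zero (pow_ne_zero _ (denom_ne_zero _ _))

theorem comp_smul_eq (f : ℍ → ℂ) (γ : SL(2, ℤ)) :
    (fun z : ℂ => f (γ • ofComplex z))
      = (fun z : ℂ => f (ofComplex z)) ∘ fun w : ℂ => ((γ • ofComplex w : ℍ) : ℂ) := by
  funext z
  simp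

theorem IsMeromorphic.comp_smul {f : ℍ → ℂ} (hf : IsMeromorphic f) (γ : SL(2, ℤ)) :
    IsMeromorphic (fun τ => f (γ • τ)) := by
  intro τ
  rw [comp_smul_eq]
  refine (meromorphicAt_comp_iff_of_deriv_ne_zero (analyticAt_smul_int γ τ)
    (deriv_smul_int_ne_zero γ τ)).mpr ?_
  simpa using hf (γ • τ)

theorem ordAt_comp_smul (f : ℍ → ℂ) (γ : SL(2, ℤ)) (τ : ℍ) :
    ordAt (fun τ => f (γ • τ)) τ = ordAt f (γ • τ) := by
  rw [ordAt, comp_smul_eq, meromorphicOrderAt_comp_of_deriv_ne_zero (analyticAt_smul_int γ τ)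
    (deriv_smul_int_ne_zero γ τ), ordAt]
  simp

end Orders

/-! ### Orders at the cusp `i∞` -/

section CuspOrder

/-- `g` behaves like a nonzero multiple of `q^r` at `i∞`. -/
def CuspOrder (g : ℍ → ℂ) (r : ℚ) : Prop :=
  ∃ c : ℂ, c ≠ 0 ∧ Tendsto (fun τ : ℍ => g τ * Complex.exp (2 * Real.pi * Complex.I * (-r) * τ))
    (atImInfty ⊓ codiscrete ℍ) (𝓝 c)

theorem CuspOrder.congr {f g : ℍ → ℂ} {r : ℚ} (hf : CuspOrder f r) (h : f =ᶠ[codiscrete ℍ] g) :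
    CuspOrder g r := by
  obtain ⟨c, hc, h1⟩ := hf
  refine ⟨c, hc, h1.congr' ?_⟩
  filter_upwards [h.filter_mono inf_le_right] with τ hτ
  rw [hτ]

/-- Limits multiply directly, without any product of Puiseux expansions; this is the advantage of
`CuspOrder` over `HasOrdAtImInfty`. -/
theorem CuspOrder.mul {f g : ℍ → ℂ} {r s : ℚ} (hf : CuspOrder f r) (hg : CuspOrder g s) :
    CuspOrder (fun τ => f τ * g τ) (r + s) := by
  obtain ⟨c, hc, h1⟩ := hf
  obtain ⟨d, hd, h2⟩ := hg
  refine ⟨c * d, mul_ne_zero hc hd, (h1.mul h2).congr fun τ => ?_⟩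
  have : (2 * Real.pi * Complex.I * (-((r + s : ℚ) : ℂ)) * τ : ℂ)
      = 2 * Real.pi * Complex.I * (-r) * τ + 2 * Real.pi * Complex.I * (-s) * τ := by
    push_cast
    ring
  rw [this, Complex.exp_add]
  ring

theorem cuspOrder_one : CuspOrder (fun _ => 1) 0 :=
  ⟨1, one_ne_zero, by simpa using tendsto_const_nhds⟩

theorem CuspOrder.pow {f : ℍ → ℂ} {r : ℚ} (hf : CuspOrder f r) (n : ℕ) :
    CuspOrder (fun τ => f τ ^ n) (n * r) := by
  induction n with
  | zero => simpa using cuspOrder_one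
  | succ n ih =>
    have := ih.mul hf
    simp only [pow_succ]
    convert this using 1
    push_cast
    ring

theorem CuspOrder.inv {f : ℍ → ℂ} {r : ℚ} (hf : CuspOrder f r) :
    CuspOrder (fun τ => (f τ)⁻¹) (-r) := by
  obtain ⟨c, hc, h1⟩ := hf
  refine ⟨c⁻¹, inv_ne_zero hc, (h1.inv₀ hc).congr fun τ => ?_⟩
  rw [mul_inv, ← Complex.exp_neg]
  congr 2
  push_cast
  ring

theorem CuspOrder.zpow {f : ℍ → ℂ} {r : ℚ} (hf : CuspOrder f r) (n : ℤ) :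
    CuspOrder (fun τ => f τ ^ n) (n * r) := by
  obtain ⟨m, rfl | rfl⟩ := n.eq_nat_or_neg
  · simpa using hf.pow m
  · simpa using (hf.pow m).inv

theorem CuspOrder.prod {ι : Type*} {s : Finset ι} {f : ι → ℍ → ℂ} {r : ι → ℚ}
    (hf : ∀ i ∈ s, CuspOrder (f i) (r i)) :
    CuspOrder (fun τ => ∏ i ∈ s, f i τ) (∑ i ∈ s, r i) := by
  classical
  induction s using Finset.induction with
  | empty => simpa using cuspOrder_one
  | insert i s hi ih =>
    simp only [Finset.prod_insert hi, Finset.sum_insert hi]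
    exact (hf i (Finset.mem_insert_self i s)).mul
      (ih fun j hj => hf j (Finset.mem_insert_of_mem hj))

/-- Sets in `atImInfty ⊓ codiscrete ℍ` contain punctured neighbourhoods of all points of large
imaginary part. -/
theorem exists_forall_eventually_nhdsNE {P : ℍ → Prop}
    (h : ∀ᶠ τ in atImInfty ⊓ codiscrete ℍ, P τ) :
    ∃ A : ℝ, ∀ τ : ℍ, A < τ.im → ∀ᶠ τ' in 𝓝[≠] τ, P τ' := by
  obtain ⟨S, hS, T, hT, hST⟩ := mem_inf_iff_superset.mp h
  obtain ⟨A, hA⟩ := (atImInfty_mem S).mp hS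
  refine ⟨A, fun τ hτ => ?_⟩
  have h1 : ∀ᶠ τ' in 𝓝[≠] τ, A < τ'.im :=
    mem_nhdsWithin_of_mem_nhds
      ((isOpen_lt continuous_const UpperHalfPlane.continuous_im).mem_nhds hτ)
  filter_upwards [h1, eventually_codiscrete_iff.mp hT τ] with τ' h2 h3
  exact hST ⟨hA τ' h2.le, h3⟩

/-- High in the half-plane f q^(-r) stays within ‖c‖/2 of c ≠ 0 off a discrete set, which excludes
zeros and poles; the exponential factor does not affect orders. -/
theorem CuspOrder.exists_ordAt_eq_zero {f : ℍ → ℂ} {r : ℚ} (hf : CuspOrder f r)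
    (hm : IsMeromorphic f) : ∃ A : ℝ, ∀ τ : ℍ, A < τ.im → ordAt f τ = 0 := by
  obtain ⟨c, hc, h1⟩ := hf
  have hev := h1.eventually (Metric.ball_mem_nhds c (half_pos (norm_pos_iff.mpr hc)))
  obtain ⟨A, hA⟩ := exists_forall_eventually_nhdsNE hev
  refine ⟨A, fun τ hτ => ?_⟩
  set e : ℂ → ℂ := fun z => Complex.exp (2 * Real.pi * Complex.I * (-r) * z)
  have he : AnalyticAt ℂ e τ := by fun_prop
  set F : ℂ → ℂ := fun z => f (ofComplex z)
  have hord : meromorphicOrderAt (e * F) τ = ordAt f τ :=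
    meromorphicOrderAt_mul_of_ne_zero he (Complex.exp_ne_zero _)
  have hmer : MeromorphicAt (e * F) τ := he.meromorphicAt.mul (hm τ)
  have hnear : ∀ᶠ z : ℂ in 𝓝[≠] (τ : ℂ), dist ((e * F) z) c < ‖c‖ / 2 := by
    have h2 := (eventually_nhdsNE_coe_iff (P := fun τ : ℍ => dist (f τ * e τ) c < ‖c‖ / 2)).mpr
      (hA τ hτ)
    have h3 : ∀ᶠ z : ℂ in 𝓝[≠] (τ : ℂ), 0 < z.im :=
      mem_nhdsWithin_of_mem_nhds (isOpen_upperHalfPlaneSet.mem_nhds τ.im_pos)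
    filter_upwards [h2, h3] with z hz hz0
    rw [ofComplex_apply_of_im_pos hz0] at hz
    simpa [F, ofComplex_apply_of_im_pos hz0, mul_comm] using hz
  rw [← hord]
  by_contra hne
  rcases lt_or_gt_of_ne hne with hlt | hgt
  · have h4 := tendsto_norm_atTop_iff_cobounded.mpr (tendsto_cobounded_of_meromorphicOrderAt_neg hlt)
    obtain ⟨z, hz, hz'⟩ := (hnear.and (h4.eventually_gt_atTop (‖c‖ + ‖c‖ / 2))).exists
    have := norm_le_norm_add_norm_sub' ((e * F) z) c
    rw [← dist_eq_norm] at this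
    linarith
  · have h4 := (tendsto_zero_of_meromorphicOrderAt_pos hgt).norm
    rw [norm_zero] at h4
    obtain ⟨z, hz, hz'⟩ := (hnear.and (h4.eventually_lt_const (half_pos (norm_pos_iff.mpr hc)))).exists
    have := norm_le_norm_add_norm_sub' c ((e * F) z)
    rw [← dist_eq_norm, dist_comm] at this
    linarith

theorem CuspOrder.ordAt_ne_top {f : ℍ → ℂ} {r : ℚ} (hf : CuspOrder f r)
    (hm : IsMeromorphic f) (τ : ℍ) : ordAt f τ ≠ ⊤ := by
  obtain ⟨A, hA⟩ := hf.exists_ordAt_eq_zero hm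
  let τ₀ : ℍ := ⟨((|A| + 1 : ℝ) : ℂ) * Complex.I, by simp; positivity⟩
  have him : τ₀.im = |A| + 1 := by
    change (((|A| + 1 : ℝ) : ℂ) * Complex.I).im = _
    simp
  refine hm.ordAt_ne_top (τ := τ₀) ?_ τ
  rw [hA τ₀ (by rw [him]; linarith [le_abs_self A])]
  exact WithTop.zero_ne_top

end CuspOrder

/-! ### The modular invariant as a meromorphic function -/

section ModularInvariant

open ModularForm EisensteinSeries

theorem levelOne_smul {F : Type*} [FunLike F ℍ ℂ] {k : ℤ} [SlashInvariantFormClass F 𝒮ℒ k]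
    (f : F) (γ : SL(2, ℤ)) (τ : ℍ) : f (γ • τ) = denom γ τ ^ k * f τ := by
  have : SlashInvariantFormClass F (CongruenceSubgroup.Gamma 1) k :=
    CongruenceSubgroup.Gamma_one_coe_eq_SL ▸ ‹_›
  exact SlashInvariantForm.slash_action_eqn_SL'' f (CongruenceSubgroup.mem_Gamma_one γ) τ

theorem discriminant_smul (γ : SL(2, ℤ)) (τ : ℍ) :
    discriminant (γ • τ) = denom γ τ ^ 12 * discriminant τ := by
  have := levelOne_smul CuspForm.discriminant γ τ
  exact_mod_cast this

theorem mdifferentiable_discriminant : MDiff discriminant := CuspForm.discriminant.holo'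

theorem mdifferentiable_jInv : MDiff jInv :=
  (E₄.holo'.pow 3).div mdifferentiable_discriminant discriminant_ne_zero

theorem jInv_smul (γ : SL(2, ℤ)) (τ : ℍ) : jInv (γ • τ) = jInv τ := by
  have h : denom γ τ ≠ 0 := denom_ne_zero _ _
  have hE : E₄ (γ • τ) = denom γ τ ^ 4 * E₄ τ := by
    exact_mod_cast levelOne_smul E₄ γ τ
  rw [jInv, jInv, discriminant_smul, hE, mul_pow, ← pow_mul]
  exact mul_div_mul_left _ _ (pow_ne_zero _ h)

theorem tendsto_cuspFunction {F : Type*} [FunLike F ℍ ℂ] {k : ℤ} [ModularFormClass F 𝒮ℒ k] (f : F) :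
    Tendsto f atImInfty (𝓝 ((qExpansion 1 f).coeff 0)) := by
  have han := ModularFormClass.analyticAt_cuspFunction_zero f one_pos one_mem_strictPeriods_SL
  have hper := SlashInvariantFormClass.periodic_comp_ofComplex f one_mem_strictPeriods_SL
  have h0 : (qExpansion 1 f).coeff 0 = cuspFunction 1 f 0 := by
    rw [qExpansion_coeff_zero one_pos han hper, cuspFunction_apply_zero one_pos han hper]
  rw [h0]
  refine (han.continuousAt.tendsto.comp (qParam_tendsto_atImInfty one_pos)).congr fun τ => ?_
  exact eq_cuspFunction τ one_ne_zero hper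

theorem cuspOrder_zero_of_tendsto {f : ℍ → ℂ} {c : ℂ} (hc : c ≠ 0)
    (h : Tendsto f atImInfty (𝓝 c)) : CuspOrder f 0 :=
  ⟨c, hc, by simpa using h.mono_left inf_le_left⟩

theorem cuspOrder_qParam : CuspOrder (fun τ => Function.Periodic.qParam 1 τ) 1 := by
  refine ⟨1, one_ne_zero, tendsto_const_nhds.congr fun τ => ?_⟩
  simp only [Function.Periodic.qParam, ← Complex.exp_add]
  simp

theorem cuspOrder_discriminant : CuspOrder discriminant 1 := by
  have h := cuspOrder_qParam.mul
    (cuspOrder_zero_of_tendsto one_ne_zero tendsto_atImInfty_tprod_one_sub_eta_q_pow)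
  rw [add_zero] at h
  convert h using 2 with τ
  exact discriminant_eq_q_prod τ

theorem tendsto_E₄_atImInfty : Tendsto E₄ atImInfty (𝓝 1) := by
  have := tendsto_cuspFunction E₄
  rwa [E_qExpansion_coeff_zero (k := 4) (by norm_num) ⟨2, rfl⟩] at this

/-- The simple pole comes from j - c = (E₄³ - cΔ)/Δ, whose numerator tends to 1. -/
theorem cuspOrder_jInv_sub (c : ℂ) : CuspOrder (fun τ => jInv τ - c) (-1) := by
  have h1 : Tendsto (fun τ => E₄ τ ^ 3 - c * discriminant τ) atImInfty (𝓝 1) := by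
    simpa using (tendsto_E₄_atImInfty.pow 3).sub
      ((show Tendsto discriminant atImInfty (𝓝 0) from discriminant_isZeroAtImInfty).const_mul c)
  have h := (cuspOrder_zero_of_tendsto one_ne_zero h1).mul cuspOrder_discriminant.inv
  rw [zero_add] at h
  convert h using 2 with τ
  have := discriminant_ne_zero τ
  rw [jInv]
  field_simp

theorem mdifferentiable_jInv_sub (c : ℂ) : MDiff (fun τ => jInv τ - c) := by
  rw [UpperHalfPlane.mdifferentiable_iff]
  exact (UpperHalfPlane.mdifferentiable_iff.mp mdifferentiable_jInv).sub_const c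

theorem isMeromorphic_jInv_sub (c : ℂ) : IsMeromorphic (fun τ => jInv τ - c) :=
  isMeromorphic_of_mdifferentiable (mdifferentiable_jInv_sub c)

theorem ordAt_jInv_sub_ne_top (c : ℂ) (τ : ℍ) : ordAt (fun τ => jInv τ - c) τ ≠ ⊤ :=
  (cuspOrder_jInv_sub c).ordAt_ne_top (isMeromorphic_jInv_sub c) τ

/-- The ramification index of `jInv` at `τ`. -/
def jRam (τ : ℍ) : ℤ := (ordAt (fun τ' => jInv τ' - jInv τ) τ).untop₀

theorem ordAt_jInv_sub_self (τ : ℍ) : ordAt (fun τ' => jInv τ' - jInv τ) τ = jRam τ :=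
  (WithTop.coe_untop₀_of_ne_top (ordAt_jInv_sub_ne_top _ τ)).symm

theorem ordAt_jInv_sub {τ : ℍ} {c : ℂ} (h : jInv τ ≠ c) : ordAt (fun τ' => jInv τ' - c) τ = 0 :=
  ordAt_eq_zero_of_mdifferentiable (mdifferentiable_jInv_sub c) (sub_ne_zero.mpr h)

theorem jRam_pos (τ : ℍ) : 0 < jRam τ := by
  have han := analyticAt_of_mdifferentiable (mdifferentiable_jInv_sub (jInv τ)) τ
  have h0 := han.meromorphicOrderAt_nonneg
  have h1 := han.meromorphicNFAt.meromorphicOrderAt_eq_zero_iff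
  have h2 : (0 : WithTop ℤ) ≤ jRam τ := by
    rw [← ordAt_jInv_sub_self]
    exact h0
  have h3 : ((jRam τ : ℤ) : WithTop ℤ) ≠ 0 := by
    rw [← ordAt_jInv_sub_self]
    exact fun h => (h1.mp h) (by simp)
  have h4 : 0 ≤ jRam τ := by exact_mod_cast h2
  have h5 : jRam τ ≠ 0 := by exact_mod_cast h3
  omega

theorem jRam_smul (γ : SL(2, ℤ)) (τ : ℍ) : jRam (γ • τ) = jRam τ := by
  rw [jRam, jRam, jInv_smul, ← ordAt_comp_smul (fun τ' => jInv τ' - jInv τ)]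
  simp only [jInv_smul]

end ModularInvariant

/-! ### Invariant functions without zeros and poles -/

section NoZeros

open scoped ModularForm

/-- The values of g on a discrete set are arbitrary. Passing to the meromorphic normal form repairs
them, and a normal form of order zero is analytic and nonvanishing. -/
theorem exists_holomorphic_representative {g : ℍ → ℂ} (hm : IsMeromorphic g)
    (h0 : ∀ τ, ordAt g τ = 0) :
    ∃ G : ℍ → ℂ, MDiff G ∧ (∀ τ, G τ ≠ 0) ∧ G =ᶠ[codiscrete ℍ] g := by
  set F : ℂ → ℂ := fun z => g (ofComplex z)
  set N := toMeromorphicNFOn F upperHalfPlaneSet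
  have hN : MeromorphicNFOn N upperHalfPlaneSet := meromorphicNFOn_toMeromorphicNFOn F _
  have hord : ∀ τ : ℍ, meromorphicOrderAt N τ = 0 := fun τ => by
    rw [meromorphicOrderAt_toMeromorphicNFOn hm.meromorphicOn τ.im_pos]
    exact h0 τ
  refine ⟨fun τ => N τ, ?_, fun τ => ?_, ?_⟩
  · rw [UpperHalfPlane.mdifferentiable_iff]
    intro z hz
    have han : AnalyticAt ℂ N z :=
      (hN hz).meromorphicOrderAt_nonneg_iff_analyticAt.mp (hord ⟨z, hz⟩).ge
    refine (han.differentiableAt.congr_of_eventuallyEq ?_).differentiableWithinAt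
    filter_upwards [isOpen_upperHalfPlaneSet.mem_nhds hz] with w hw
    simp [ofComplex_apply_of_im_pos hw]
  · exact (hN τ.im_pos).meromorphicOrderAt_eq_zero_iff.mp (hord τ)
  · refine eventually_codiscrete_iff.mpr fun τ => ?_
    rw [← eventually_nhdsNE_coe_iff]
    have h3 : ∀ᶠ z : ℂ in 𝓝[≠] (τ : ℂ), 0 < z.im :=
      mem_nhdsWithin_of_mem_nhds (isOpen_upperHalfPlaneSet.mem_nhds τ.im_pos)
    filter_upwards [hm.meromorphicOn.toMeromorphicNFOn_eq_self_on_nhdsNE τ.im_pos, h3] with z hz hz0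
    simpa [ofComplex_apply_of_im_pos hz0, F] using hz

theorem eq_of_eventually_codiscrete_eq {f g : ℍ → ℂ} (hf : Continuous f) (hg : Continuous g)
    (h : f =ᶠ[codiscrete ℍ] g) : f = g := by
  funext τ
  have hne : (𝓝[≠] τ).NeBot := by
    have : Nontrivial ℍ := ⟨⟨UpperHalfPlane.I, (1 : ℝ) +ᵥ UpperHalfPlane.I, fun h => by
      simpa using congrArg UpperHalfPlane.re h⟩⟩
    infer_instance
  exact tendsto_nhds_unique_of_eventuallyEq (hf.continuousAt.tendsto.mono_left nhdsWithin_le_nhds)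
    (hg.continuousAt.tendsto.mono_left nhdsWithin_le_nhds) (eventually_codiscrete_iff.mp h τ)

theorem norm_exp_neg_mul (r : ℚ) (τ : ℍ) :
    ‖Complex.exp (2 * Real.pi * Complex.I * (-r) * τ)‖ = Real.exp (2 * Real.pi * r * τ.im) := by
  rw [Complex.norm_exp]
  congr 1
  have : (2 * Real.pi * Complex.I * (-r) * τ : ℂ)
      = ((2 * Real.pi * r : ℝ) : ℂ) * (-(τ * Complex.I)) := by
    push_cast
    ring
  rw [this, Complex.re_ofReal_mul]
  simp

theorem isBoundedAtImInfty_of_cuspOrder {G : ℍ → ℂ} (hG : Continuous G) {r : ℚ}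
    (hr : CuspOrder G r) (hr0 : 0 ≤ r) : IsBoundedAtImInfty G := by
  obtain ⟨c, hc, h⟩ := hr
  have hev : ∀ᶠ τ in atImInfty ⊓ codiscrete ℍ, ‖G τ‖ ≤ ‖c‖ + 1 := by
    have h1 := h.norm.eventually_lt_const (show ‖c‖ < ‖c‖ + 1 by linarith)
    filter_upwards [h1] with τ hτ
    rw [norm_mul, norm_exp_neg_mul] at hτ
    refine le_trans ?_ hτ.le
    refine le_mul_of_one_le_right (norm_nonneg _) (Real.one_le_exp ?_)
    have := Real.pi_pos
    have := τ.im_pos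
    have : (0 : ℝ) ≤ r := by exact_mod_cast hr0
    positivity
  obtain ⟨A, hA⟩ := exists_forall_eventually_nhdsNE hev
  rw [isBoundedAtImInfty_iff]
  refine ⟨‖c‖ + 1, A + 1, fun τ hτ => ?_⟩
  have hne : (𝓝[≠] τ).NeBot := by
    have : Nontrivial ℍ := ⟨⟨UpperHalfPlane.I, (1 : ℝ) +ᵥ UpperHalfPlane.I, fun h => by
      simpa using congrArg UpperHalfPlane.re h⟩⟩
    infer_instance
  -- The bound is known only off a discrete set; continuity of G extends it to every τ.
  exact le_of_tendsto (hG.norm.continuousAt.tendsto.mono_left nhdsWithin_le_nhds)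
    (hA τ (by linarith))

theorem exists_const_of_invariant {G : ℍ → ℂ} (hG : MDiff G)
    (hinv : ∀ (γ : SL(2, ℤ)) (τ : ℍ), G (γ • τ) = G τ) (hb : IsBoundedAtImInfty G) :
    ∃ c, G = Function.const _ c := by
  have hslash : ∀ γ : SL(2, ℤ), G ∣[(0 : ℤ)] γ = G := by
    intro γ
    ext τ
    rw [ModularForm.SL_slash_apply, hinv]
    simp
  let Φ : ModularForm 𝒮ℒ 0 :=
    { toFun := G
      slash_action_eq' := fun _ ⟨γ, hγ⟩ => hγ ▸ hslash γ
      holo' := hG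
      bdd_at_cusps' := fun {c} hc => by
        rw [Subgroup.IsArithmetic.isCusp_iff_isCusp_SL2Z] at hc
        rw [OnePoint.isBoundedAt_iff_forall_SL2Z hc]
        intro γ _
        rw [hslash γ]
        exact hb }
  exact ModularFormClass.levelOne_weight_zero_const Φ

/-- A nonnegative order makes the holomorphic representative bounded at the cusp, so it is a
level-one form of weight zero, that is, a nonzero constant. -/
theorem cuspOrder_eq_zero_of_nonneg {g : ℍ → ℂ} (hm : IsMeromorphic g) (h0 : ∀ τ, ordAt g τ = 0)
    (hinv : ∀ γ : SL(2, ℤ), (fun τ => g (γ • τ)) =ᶠ[codiscrete ℍ] g) {r : ℚ} (hr : CuspOrder g r)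
    (hr0 : 0 ≤ r) : r = 0 := by
  obtain ⟨G, hG, hG0, hGg⟩ := exists_holomorphic_representative hm h0
  have hGinv : ∀ (γ : SL(2, ℤ)) (τ : ℍ), G (γ • τ) = G τ := by
    intro γ
    refine congrFun (eq_of_eventually_codiscrete_eq (f := fun τ => G (γ • τ)) ?_ hG.continuous ?_)
    · exact hG.continuous.comp (continuous_const_smul (γ : GL (Fin 2) ℝ))
    · filter_upwards [eventually_codiscrete_smul hGg γ, hinv γ, hGg] with τ h1 h2 h3
      rw [h1, h2, h3]
  have hrG := hr.congr hGg.symm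
  obtain ⟨c, rfl⟩ :=
    exists_const_of_invariant hG hGinv (isBoundedAtImInfty_of_cuspOrder hG.continuous hrG hr0)
  by_contra hne
  have hpos : (0 : ℝ) < r := by exact_mod_cast lt_of_le_of_ne hr0 (Ne.symm hne)
  obtain ⟨d, -, hd⟩ := hrG
  have hnb := neBot_atImInfty_codiscrete
  have him : Tendsto (fun τ : ℍ => τ.im) (atImInfty ⊓ codiscrete ℍ) atTop :=
    tendsto_comap.mono_left inf_le_left
  have hexp : Tendsto (fun τ : ℍ => ‖c‖ * Real.exp (2 * Real.pi * r * τ.im))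
      (atImInfty ⊓ codiscrete ℍ) atTop :=
    (Real.tendsto_exp_atTop.comp (him.const_mul_atTop
      (by have := Real.pi_pos; positivity))).const_mul_atTop
      (norm_pos_iff.mpr (hG0 UpperHalfPlane.I))
  -- For a nonzero constant and r > 0, multiplication by q^(-r) diverges at the cusp, against the
  -- definition of `CuspOrder`.
  refine not_tendsto_nhds_of_tendsto_atTop hexp ‖d‖ (hd.norm.congr fun τ => ?_)
  rw [norm_mul, norm_exp_neg_mul, Function.const_apply]

theorem cuspOrder_eq_zero {g : ℍ → ℂ} (hm : IsMeromorphic g) (h0 : ∀ τ, ordAt g τ = 0)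
    (hinv : ∀ γ : SL(2, ℤ), (fun τ => g (γ • τ)) =ᶠ[codiscrete ℍ] g) {r : ℚ} (hr : CuspOrder g r) :
    r = 0 := by
  rcases le_total 0 r with h | h
  · exact cuspOrder_eq_zero_of_nonneg hm h0 hinv hr h
  · refine neg_eq_zero.mp (cuspOrder_eq_zero_of_nonneg hm.inv (fun τ => ?_) (fun γ => ?_) hr.inv
      (neg_nonneg.mpr h))
    · rw [ordAt_inv, h0]
      rfl
    · filter_upwards [hinv γ] with τ hτ
      rw [hτ]

end NoZeros

/-! ### The valence formula in level one, in terms of the ramification of `j` -/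

section LevelOne

/-- The orbits of `PSL(2, ℤ)` on `ℍ`. -/
abbrev LevelOneOrbit : Type := MulAction.orbitRel.Quotient PSL(2, ℤ) ℍ

/-- The `PSL(2, ℤ)`-orbit of `τ`. -/
def levelOneMk (τ : ℍ) : LevelOneOrbit := Quotient.mk _ τ

theorem levelOneMk_out (y : LevelOneOrbit) : levelOneMk y.out = y := Quotient.out_eq y

theorem levelOneMk_eq_iff {τ₁ τ₂ : ℍ} :
    levelOneMk τ₁ = levelOneMk τ₂ ↔ ∃ γ : SL(2, ℤ), γ • τ₂ = τ₁ := by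
  rw [levelOneMk, levelOneMk, Quotient.eq, MulAction.orbitRel_apply, MulAction.mem_orbit_iff]
  constructor
  · rintro ⟨p, hp⟩
    obtain ⟨γ, rfl⟩ := QuotientGroup.mk_surjective p
    exact ⟨γ, hp⟩
  · rintro ⟨γ, hγ⟩
    exact ⟨QuotientGroup.mk γ, hγ⟩

theorem levelOneMk_eq_iff_jInv {τ₁ τ₂ : ℍ} :
    levelOneMk τ₁ = levelOneMk τ₂ ↔ jInv τ₁ = jInv τ₂ := by
  rw [levelOneMk_eq_iff]
  refine ⟨?_, exists_smul_eq_of_jInv_eq⟩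
  rintro ⟨γ, rfl⟩
  exact jInv_smul γ τ₂

theorem eq_out_of_smul_invariant {α : Type*} {F : ℍ → α}
    (hF : ∀ (γ : SL(2, ℤ)) τ, F (γ • τ) = F τ) (τ : ℍ) : F (levelOneMk τ).out = F τ := by
  obtain ⟨γ, hγ⟩ := levelOneMk_eq_iff.mp (levelOneMk_out (levelOneMk τ))
  rw [← hγ, hF]

theorem ordAt_smul_of_invariant {h : ℍ → ℂ}
    (hinv : ∀ γ : SL(2, ℤ), (fun τ => h (γ • τ)) =ᶠ[codiscrete ℍ] h) (γ : SL(2, ℤ)) (τ : ℍ) :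
    ordAt h (γ • τ) = ordAt h τ := by
  rw [← ordAt_comp_smul, ordAt_congr (hinv γ)]

theorem IsMeromorphic.eventually_ordAt_eq_zero {h : ℍ → ℂ} (hm : IsMeromorphic h)
    (hne : ∀ τ, ordAt h τ ≠ ⊤) (τ : ℍ) : ∀ᶠ τ' in 𝓝[≠] τ, ordAt h τ' = 0 := by
  rw [← eventually_nhdsNE_coe_iff]
  have h1 : ∀ᶠ z : ℂ in 𝓝[≠] (τ : ℂ), 0 < z.im :=
    mem_nhdsWithin_of_mem_nhds (isOpen_upperHalfPlaneSet.mem_nhds τ.im_pos)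
  have h2 := (meromorphicOrderAt_ne_top_iff_eventually_ne_zero (hm τ)).mp (hne τ)
  filter_upwards [h1, h2, (hm τ).eventually_analyticAt] with z hz1 hz2 hz3
  rw [ofComplex_apply_of_im_pos hz1]
  exact hz3.meromorphicNFAt.meromorphicOrderAt_eq_zero_iff.mpr hz2

/-! ### Finiteness of zeros and poles modulo PSL(2, ℤ), and the degree formula. -/

/-- The rectangle contains the part of the standard fundamental domain of height at most A, since
(Im τ)² ≥ 3/4 there. -/
theorem isCompact_rectangle (A : ℝ) :
    IsCompact {τ : ℍ | |τ.re| ≤ 1 / 2 ∧ 1 / 2 ≤ τ.im ∧ τ.im ≤ A} := by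
  have h1 : IsCompact (Set.Icc (-(1 / 2) : ℝ) (1 / 2) ×ℂ Set.Icc (1 / 2 : ℝ) A) :=
    isCompact_Icc.reProdIm isCompact_Icc
  have h2 := isEmbedding_coe.isInducing.isCompact_preimage' h1 (fun z hz => by
    have him : (1 / 2 : ℝ) ≤ z.im := hz.2.1
    exact ⟨⟨z, by linarith⟩, rfl⟩)
  convert h2 using 1
  ext τ
  simp only [Set.mem_ofPred_eq, Set.mem_preimage, Complex.mem_reProdIm, Set.mem_Icc, abs_le,
    coe_re, coe_im]

theorem finite_inter_of_eventually_notMem {X : Type*} [TopologicalSpace X] {K S : Set X}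
    (hK : IsCompact K) (h : ∀ x, ∀ᶠ y in 𝓝[≠] x, y ∉ S) : (K ∩ S).Finite := by
  obtain ⟨t, -, ht⟩ := hK.elim_nhds_subcover (fun x => {y | y ∉ S} ∪ {x})
    (fun x _ => by
      have := h x
      rw [eventually_nhdsWithin_iff] at this
      filter_upwards [this] with y hy
      by_cases hyx : y = x
      · exact Or.inr hyx
      · exact Or.inl (hy hyx))
  refine t.finite_toSet.subset fun y hy => ?_
  obtain ⟨x, hx, hyx⟩ := Set.mem_iUnion₂.mp (ht hy.1)
  rcases hyx with hyx | hyx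
  · exact absurd hy.2 hyx
  · rw [Set.mem_singleton_iff.mp hyx]
    exact hx

/-- Each orbit meets the fundamental domain, the behaviour at the cusp bounds the height of zeros
and poles, and these are isolated in the remaining compact set. -/
theorem finite_setOf_ordAt_ne_zero {h : ℍ → ℂ} (hm : IsMeromorphic h)
    (hinv : ∀ γ : SL(2, ℤ), (fun τ => h (γ • τ)) =ᶠ[codiscrete ℍ] h) {r : ℚ}
    (hr : CuspOrder h r) : {y : LevelOneOrbit | ordAt h y.out ≠ 0}.Finite := by
  obtain ⟨A, hA⟩ := hr.exists_ordAt_eq_zero hm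
  have hfin := finite_inter_of_eventually_notMem (S := {τ | ordAt h τ ≠ 0}) (isCompact_rectangle A)
    (fun τ => by simpa using hm.eventually_ordAt_eq_zero (hr.ordAt_ne_top hm) τ)
  refine (hfin.image levelOneMk).subset fun y hy => ?_
  obtain ⟨γ, hγ⟩ := ModularGroup.exists_smul_mem_fd y.out
  have hord : ordAt h (γ • y.out) ≠ 0 := by
    rw [ordAt_smul_of_invariant hinv]
    exact hy
  refine ⟨γ • y.out, ⟨⟨hγ.2, ?_, ?_⟩, hord⟩, ?_⟩
  · have h1 := ModularGroup.three_le_four_mul_im_sq_of_mem_fd hγ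
    have h2 := (γ • y.out).im_pos
    nlinarith
  · by_contra hlt
    exact hord (hA _ (not_le.mp hlt))
  · rw [← levelOneMk_out y]
    exact levelOneMk_eq_iff.mpr ⟨γ, by rw [levelOneMk_out]⟩

open Classical in
-- Separation of orbits enters here: j - j(y) vanishes on the single orbit y.
theorem ordAt_jInv_sub_out (y : LevelOneOrbit) (τ : ℍ) :
    ordAt (fun τ' => jInv τ' - jInv y.out) τ
      = if y = levelOneMk τ then (jRam y.out : WithTop ℤ) else 0 := by
  split_ifs with h
  · have hj : jInv τ = jInv y.out := by
      rw [← levelOneMk_eq_iff_jInv, levelOneMk_out, h]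
    rw [← hj, ordAt_jInv_sub_self, h, eq_out_of_smul_invariant jRam_smul]
  · refine ordAt_jInv_sub fun hj => h ?_
    rw [← levelOneMk_eq_iff_jInv, levelOneMk_out] at hj
    exact hj.symm

/-- Dividing h by the product of (j - j(y))^(o(y)/n(y)) would remove all zeros and poles. The
exponents need not be integers, so the argument is run with h^K, where K is a common multiple of the
ramification indices n(y). -/
theorem levelOne_valence_jRam {h : ℍ → ℂ} (hm : IsMeromorphic h)
    (hinv : ∀ γ : SL(2, ℤ), (fun τ => h (γ • τ)) =ᶠ[codiscrete ℍ] h) {r : ℚ}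
    (hr : CuspOrder h r) :
    r + ∑ᶠ y : LevelOneOrbit, ((ordAt h y.out).untop₀ : ℚ) / jRam y.out = 0 := by
  classical
  set S : Finset LevelOneOrbit := (finite_setOf_ordAt_ne_zero hm hinv hr).toFinset with hS
  set o : LevelOneOrbit → ℤ := fun y => (ordAt h y.out).untop₀ with ho
  set n : LevelOneOrbit → ℤ := fun y => jRam y.out with hn
  have hnpos : ∀ y, 0 < n y := fun y => jRam_pos _
  set K : ℤ := ∏ y ∈ S, n y with hK
  -- This is K / n(y) on S, written without division.
  set m : LevelOneOrbit → ℤ := fun y => ∏ y' ∈ S.erase y, n y' with hmdef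
  have hKm : ∀ y ∈ S, m y * n y = K := fun y hy => Finset.prod_erase_mul S n hy
  have hoOrd : ∀ τ, ordAt h τ = o (levelOneMk τ) := fun τ => by
    rw [ho]
    simp only
    rw [eq_out_of_smul_invariant (ordAt_smul_of_invariant hinv),
      WithTop.coe_untop₀_of_ne_top (hr.ordAt_ne_top hm τ)]
  have hmemS : ∀ y, y ∉ S → o y = 0 := fun y hy => by
    have : ordAt h y.out = 0 := by
      by_contra hne
      exact hy ((Set.Finite.mem_toFinset _).mpr hne)
    simp [ho, this]
  have hfac : ∀ y, IsMeromorphic (fun τ => (jInv τ - jInv y.out) ^ (-(m y * o y))) :=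
    fun y => (isMeromorphic_jInv_sub _).zpow _
  set g : ℍ → ℂ := fun τ => h τ ^ K * ∏ y ∈ S, (jInv τ - jInv y.out) ^ (-(m y * o y)) with hg
  have hgm : IsMeromorphic g := (hm.zpow K).mul (IsMeromorphic.prod fun y _ => hfac y)
  have hg0 : ∀ τ, ordAt g τ = 0 := by
    intro τ
    rw [hg, ordAt_mul (hm.zpow K) (IsMeromorphic.prod fun y _ => hfac y), ordAt_zpow hm,
      ordAt_prod fun y _ => hfac y, hoOrd]
    have hterm : ∀ y ∈ S, ordAt (fun τ => (jInv τ - jInv y.out) ^ (-(m y * o y))) τ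
        = ((if y = levelOneMk τ then -(K * o y) else 0 : ℤ) : WithTop ℤ) := by
      intro y hy
      rw [ordAt_zpow (isMeromorphic_jInv_sub _), ordAt_jInv_sub_out]
      split_ifs
      · rw [← hKm y hy]
        change (((-(m y * o y)) : ℤ) : WithTop ℤ) * ((n y : ℤ) : WithTop ℤ) = _
        rw [← WithTop.coe_mul]
        congr 1
        ring
      · simp
    rw [Finset.sum_congr rfl hterm, ← WithTop.coe_sum, Finset.sum_ite_eq', ← WithTop.coe_mul,
      ← WithTop.coe_add, ← WithTop.coe_zero]
    congr 1
    split_ifs with hy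
    · ring
    · rw [hmemS _ hy]
      ring
  have hginv : ∀ γ : SL(2, ℤ), (fun τ => g (γ • τ)) =ᶠ[codiscrete ℍ] g := by
    intro γ
    filter_upwards [hinv γ] with τ hτ
    simp only [hg, hτ, jInv_smul]
  have hgr : CuspOrder g (K * r + ∑ y ∈ S, ((-(m y * o y) : ℤ) : ℚ) * (-1)) :=
    (hr.zpow K).mul (CuspOrder.prod fun y _ => (cuspOrder_jInv_sub _).zpow _)
  have hzero := cuspOrder_eq_zero hgm hg0 hginv hgr
  have hKpos : (0 : ℚ) < K := by exact_mod_cast Finset.prod_pos fun y _ => hnpos y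
  have hsum : ∑ᶠ y : LevelOneOrbit, ((ordAt h y.out).untop₀ : ℚ) / jRam y.out
      = ∑ y ∈ S, (o y : ℚ) / n y := by
    refine finsum_eq_sum_of_support_subset _ fun y hy => ?_
    by_contra hyS
    have := hmemS y hyS
    simp only [ho] at this
    simp [this] at hy
  have hsum2 : ∑ y ∈ S, ((-(m y * o y) : ℤ) : ℚ) * (-1) = K * ∑ y ∈ S, (o y : ℚ) / n y := by
    rw [Finset.mul_sum]
    refine Finset.sum_congr rfl fun y hy => ?_
    rw [← hKm y hy]
    have : (n y : ℚ) ≠ 0 := by exact_mod_cast (hnpos y).ne'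
    push_cast
    field_simp
  rw [hsum2, ← mul_add] at hzero
  rw [hsum]
  exact (mul_eq_zero.mp hzero).resolve_left hKpos.ne'

end LevelOne

/-! ### Ramification of `j` -/

section Ramification

open ModularForm EisensteinSeries Derivative
open scoped ModularForm

theorem normalizedDerivOfComplex_eq_qParam_mul {F : Type*} [FunLike F ℍ ℂ] {k : ℤ}
    [ModularFormClass F 𝒮ℒ k] (f : F) (τ : ℍ) :
    normalizedDerivOfComplex f τ = Function.Periodic.qParam 1 τ
      * deriv (cuspFunction 1 f) (Function.Periodic.qParam 1 τ) := by
  have hper := SlashInvariantFormClass.periodic_comp_ofComplex f one_mem_strictPeriods_SL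
  have hdiff : DifferentiableAt ℂ (cuspFunction 1 f) (Function.Periodic.qParam 1 τ) :=
    ModularFormClass.differentiableAt_cuspFunction f one_pos one_mem_strictPeriods_SL
      (Function.Periodic.norm_qParam_lt_one one_pos τ.im_pos)
  have hq : HasDerivAt (Function.Periodic.qParam 1)
      (Function.Periodic.qParam 1 τ * (2 * Real.pi * Complex.I)) τ := by
    have h1 : Function.Periodic.qParam 1 = fun z => Complex.exp (2 * Real.pi * Complex.I * z) := by
      funext z
      simp [Function.Periodic.qParam]
    rw [h1]
    simpa using ((hasDerivAt_id (τ : ℂ)).const_mul (2 * Real.pi * Complex.I)).cexp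
  have heq : (f : ℍ → ℂ) ∘ ofComplex =ᶠ[𝓝 (τ : ℂ)]
      fun z => cuspFunction 1 f (Function.Periodic.qParam 1 z) := by
    filter_upwards [isOpen_upperHalfPlaneSet.mem_nhds τ.im_pos] with z hz
    have := eq_cuspFunction (h := 1) (f := f) ⟨z, hz⟩ one_ne_zero hper
    simpa [ofComplex_apply_of_im_pos hz] using this.symm
  rw [normalizedDerivOfComplex, heq.deriv_eq]
  have := (hdiff.hasDerivAt.comp (τ : ℂ) hq).deriv
  rw [show (fun z => cuspFunction 1 f (Function.Periodic.qParam 1 z))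
    = cuspFunction 1 f ∘ Function.Periodic.qParam 1 from rfl, this]
  have := Complex.two_pi_I_ne_zero
  field_simp

theorem tendsto_deriv_cuspFunction {F : Type*} [FunLike F ℍ ℂ] {k : ℤ} [ModularFormClass F 𝒮ℒ k]
    (f : F) : Tendsto (fun τ : ℍ => deriv (cuspFunction 1 f) (Function.Periodic.qParam 1 τ))
      atImInfty (𝓝 ((qExpansion 1 f).coeff 1)) := by
  have han := ModularFormClass.analyticAt_cuspFunction_zero f one_pos one_mem_strictPeriods_SL
  have h1 : (qExpansion 1 f).coeff 1 = deriv (cuspFunction 1 f) 0 := by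
    rw [qExpansion_coeff]
    simp
  rw [h1]
  exact han.deriv.continuousAt.tendsto.comp (qParam_tendsto_atImInfty one_pos)

/-- With D the normalized derivative, differentiating jΔ = E₄³ gives Dj · Δ = 3E₄² DE₄ - E₄³ (DΔ/Δ).
At the cusp DE₄ tends to 0 and DΔ/Δ to 1, so the right side tends to -1. -/
theorem cuspOrder_deriv_jInv : CuspOrder (normalizedDerivOfComplex jInv) (-1) := by
  have hprod : jInv * discriminant = (E₄ : ℍ → ℂ) ^ 3 := by
    funext τ
    exact div_mul_cancel₀ _ (discriminant_ne_zero τ)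
  have hD := congrArg normalizedDerivOfComplex hprod
  rw [normalizedDerivOfComplex_mul _ _ mdifferentiable_jInv mdifferentiable_discriminant,
    normalizedDerivOfComplex_pow (⇑E₄) 3 E₄.holo'] at hD
  have hΔ : Tendsto (fun τ => normalizedDerivOfComplex discriminant τ / discriminant τ) atImInfty
      (𝓝 1) := by
    have h1 := tendsto_deriv_cuspFunction CuspForm.discriminant
    rw [CuspForm.coe_discriminant, discriminant_qExpansion_coeff_one] at h1
    have h2 := h1.div tendsto_atImInfty_tprod_one_sub_eta_q_pow one_ne_zero
    rw [div_one] at h2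
    refine h2.congr fun τ => ?_
    have h3 := normalizedDerivOfComplex_eq_qParam_mul CuspForm.discriminant τ
    rw [CuspForm.coe_discriminant] at h3
    rw [h3, discriminant_eq_q_prod]
    exact (mul_div_mul_left _ _ (Function.Periodic.qParam_ne_zero _)).symm
  have hE : Tendsto (normalizedDerivOfComplex E₄) atImInfty (𝓝 0) := by
    have h1 := (qParam_tendsto_atImInfty one_pos).mul (tendsto_deriv_cuspFunction E₄)
    rw [zero_mul] at h1
    exact h1.congr fun τ => (normalizedDerivOfComplex_eq_qParam_mul E₄ τ).symm
  have hnum : Tendsto (fun τ => 3 * E₄ τ ^ 2 * normalizedDerivOfComplex E₄ τ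
      - E₄ τ ^ 3 * (normalizedDerivOfComplex discriminant τ / discriminant τ)) atImInfty
      (𝓝 (-1)) := by
    simpa using (((tendsto_E₄_atImInfty.pow 2).const_mul 3).mul hE).sub
      ((tendsto_E₄_atImInfty.pow 3).mul hΔ)
  have h := (cuspOrder_zero_of_tendsto (by norm_num) hnum).mul cuspOrder_discriminant.inv
  rw [zero_add] at h
  convert h using 2 with τ
  have h0 := discriminant_ne_zero τ
  have hDτ := congrFun hD τ
  simp only [Pi.add_apply, Pi.mul_apply, Pi.pow_apply, Pi.natCast_apply] at hDτ
  have hj : jInv τ = E₄ τ ^ 3 / discriminant τ := rfl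
  rw [hj] at hDτ
  field_simp at hDτ ⊢
  push_cast at hDτ
  linear_combination hDτ

/-- The correction term in the transformation law of a derivative carries the weight as a factor,
and j has weight zero. -/
theorem deriv_jInv_smul (γ : SL(2, ℤ)) (τ : ℍ) :
    normalizedDerivOfComplex jInv (γ • τ) = denom γ τ ^ 2 * normalizedDerivOfComplex jInv τ := by
  have h1 := normalizedDerivOfComplex_SL_slash (k := 0) mdifferentiable_jInv (γ := γ)
  have h2 : jInv ∣[(0 : ℤ)] γ = jInv := by
    ext τ
    rw [ModularForm.SL_slash_apply, jInv_smul]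
    simp
  have h3 := congrFun h1 τ
  rw [h2] at h3
  simp only [Pi.sub_apply, Int.cast_zero, zero_mul, sub_zero, zero_add,
    ModularForm.SL_slash_apply] at h3
  have hd : denom γ τ ≠ 0 := denom_ne_zero _ _
  rw [h3, _root_.zpow_neg]
  have : denom γ τ ^ (2 : ℤ) = denom γ τ ^ 2 := by norm_cast
  rw [this]
  field_simp

theorem ordAt_deriv_jInv (τ : ℍ) :
    ordAt (normalizedDerivOfComplex jInv) τ = ((jRam τ - 1 : ℤ) : WithTop ℤ) := by
  have h1 := meromorphicOrderAt_deriv_eq_sub_one (𝕜 := ℂ) (n := jRam τ)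
    (by exact_mod_cast (jRam_pos τ).ne') (ordAt_jInv_sub_self τ)
  rw [← h1]
  have hc : (2 * Real.pi * Complex.I : ℂ)⁻¹ ≠ 0 := inv_ne_zero Complex.two_pi_I_ne_zero
  rw [← meromorphicOrderAt_mul_of_ne_zero (g := fun _ => (2 * Real.pi * Complex.I : ℂ)⁻¹)
    analyticAt_const hc]
  refine meromorphicOrderAt_congr ?_
  have h3 : ∀ᶠ z : ℂ in 𝓝[≠] (τ : ℂ), 0 < z.im :=
    mem_nhdsWithin_of_mem_nhds (isOpen_upperHalfPlaneSet.mem_nhds τ.im_pos)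
  filter_upwards [h3] with z hz
  simp only [normalizedDerivOfComplex, Pi.mul_apply, ofComplex_apply_of_im_pos hz]
  congr 1
  exact (deriv_sub_const (f := jInv ∘ ofComplex) (jInv τ)).symm

/-- The Riemann–Hurwitz formula for `j`. -/
theorem finsum_jRam : ∑ᶠ y : LevelOneOrbit, (6 * (jRam y.out - 1) : ℚ) / jRam y.out = 7 := by
  have hDm : IsMeromorphic (normalizedDerivOfComplex jInv) :=
    isMeromorphic_of_mdifferentiable
      (normalizedDerivOfComplex_mdifferentiable mdifferentiable_jInv)
  have hΔm := isMeromorphic_of_mdifferentiable mdifferentiable_discriminant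
  -- The function (Dj)^6/Δ has weight 12 - 12 = 0 and order -6 - 1 = -7 at the cusp; in ℍ only the
  -- ramification of j contributes.
  have h := levelOne_valence_jRam
    (h := fun τ => normalizedDerivOfComplex jInv τ ^ 6 * (discriminant τ)⁻¹)
    ((hDm.pow 6).mul hΔm.inv) (fun γ => Eventually.of_forall fun τ => by
      have hd : denom γ τ ≠ 0 := denom_ne_zero _ _
      have := discriminant_ne_zero τ
      simp only [deriv_jInv_smul, discriminant_smul]
      field_simp)
    ((cuspOrder_deriv_jInv.pow 6).mul cuspOrder_discriminant.inv)
  have hord : ∀ τ : ℍ, (ordAt (fun τ => normalizedDerivOfComplex jInv τ ^ 6 * (discriminant τ)⁻¹)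
      τ).untop₀ = 6 * (jRam τ - 1) := by
    intro τ
    rw [ordAt_mul (hDm.pow 6) hΔm.inv, ordAt_pow hDm, ordAt_inv,
      ordAt_eq_zero_of_mdifferentiable mdifferentiable_discriminant (discriminant_ne_zero τ),
      ordAt_deriv_jInv, neg_zero, add_zero]
    rfl
  simp only [hord] at h
  push_cast at h
  linarith

/-- The derivative of an element stabilizing `τ` is a root of unity of order dividing the
ramification index of `j`. -/
theorem denom_pow_eq_one {γ : SL(2, ℤ)} {τ : ℍ} (hγ : γ • τ = τ) :
    (denom γ τ ^ 2) ^ jRam τ = 1 := by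
  obtain ⟨G, hG, hG0, hGev⟩ := (meromorphicOrderAt_eq_int_iff
    (isMeromorphic_jInv_sub (jInv τ) τ)).mp (ordAt_jInv_sub_self τ)
  set m : ℂ → ℂ := fun w => ((γ • ofComplex w : ℍ) : ℂ) with hm
  have hmτ : m τ = τ := by simp only [hm, ofComplex_apply, hγ]
  have hder : HasDerivAt m (1 / denom γ τ ^ 2) τ := (hasStrictDerivAt_smul_int γ τ).hasDerivAt
  have hslope := hasDerivAt_iff_tendsto_slope.mp hder
  have him : ∀ᶠ z : ℂ in 𝓝[≠] (τ : ℂ), 0 < z.im :=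
    mem_nhdsWithin_of_mem_nhds (isOpen_upperHalfPlaneSet.mem_nhds τ.im_pos)
  have hmne : Tendsto m (𝓝[≠] (τ : ℂ)) (𝓝[≠] (τ : ℂ)) := by
    refine tendsto_nhdsWithin_iff.mpr ⟨?_, ?_⟩
    · have := hder.continuousAt.tendsto.mono_left (nhdsWithin_le_nhds (s := {(τ : ℂ)}ᶜ))
      rwa [hmτ] at this
    · filter_upwards [him, self_mem_nhdsWithin] with z hz hne hzτ
      have h1 : γ • ofComplex z = γ • τ := by
        rw [hγ]
        exact UpperHalfPlane.ext hzτ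
      have h2 := (MulAction.injective γ) h1
      rw [ofComplex_apply_of_im_pos hz] at h2
      exact hne (congrArg UpperHalfPlane.coe h2)
  -- Writing j - j(τ) = (z - τ)^e G(z) with G(τ) ≠ 0, invariance under m divided by (z - τ)^e gives
  -- this identity. Letting z tend to τ yields m'(τ)^e = 1.
  have hid : ∀ᶠ z in 𝓝[≠] (τ : ℂ), slope m τ z ^ jRam τ * G (m z) = G z := by
    filter_upwards [hGev, hmne.eventually hGev, self_mem_nhdsWithin] with z h1 h2 hne
    have hz : z - τ ≠ 0 := sub_ne_zero.mpr hne
    have h3 : jInv (ofComplex (m z)) = jInv (ofComplex z) := by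
      simp only [hm, ofComplex_apply, jInv_smul]
    rw [h3, h1, smul_eq_mul, smul_eq_mul] at h2
    rw [slope_def_field, hmτ, div_zpow, div_mul_eq_mul_div, ← h2]
    field_simp
  have hdne : (1 / denom γ τ ^ 2 : ℂ) ≠ 0 :=
    one_div_ne_zero (pow_ne_zero _ (denom_ne_zero _ _))
  have hlim1 : Tendsto (fun z => slope m τ z ^ jRam τ * G (m z)) (𝓝[≠] (τ : ℂ))
      (𝓝 ((1 / denom γ τ ^ 2) ^ jRam τ * G τ)) :=
    (hslope.zpow₀ _ (Or.inl hdne)).mul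
      (hG.continuousAt.tendsto.comp (hmne.mono_right nhdsWithin_le_nhds))
  have hlim2 : Tendsto G (𝓝[≠] (τ : ℂ)) (𝓝 (G τ)) :=
    hG.continuousAt.tendsto.mono_left nhdsWithin_le_nhds
  have heq := tendsto_nhds_unique_of_eventuallyEq hlim1 hlim2 hid
  have h1 : (1 / denom γ τ ^ 2) ^ jRam τ = (1 : ℂ) := by
    rwa [mul_eq_right₀ hG0] at heq
  rwa [one_div, _root_.inv_zpow, inv_eq_one] at h1

/-! ### Stabilizers as groups of roots of unity. -/

theorem denom_int_apply (γ : SL(2, ℤ)) (τ : ℍ) :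
    denom γ τ = (γ 1 0 : ℂ) * τ + (γ 1 1 : ℂ) := by
  simp [denom]

theorem denom_mul_int (γ δ : SL(2, ℤ)) (τ : ℍ) :
    denom (γ * δ : SL(2, ℤ)) τ = denom γ (δ • τ : ℍ) * denom δ τ := by
  have h0 : (δ 1 0 : ℂ) * τ + (δ 1 1 : ℂ) ≠ 0 := by
    rw [← denom_int_apply]
    exact denom_ne_zero _ _
  rw [denom_int_apply, denom_int_apply, denom_int_apply, coe_specialLinearGroup_apply]
  simp only [algebraMap_int_eq, eq_intCast, Complex.ofReal_intCast,
    Matrix.SpecialLinearGroup.coe_mul, Matrix.mul_apply, Fin.sum_univ_two, Int.cast_add,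
    Int.cast_mul]
  field_simp
  ring

/-- A real value ±1 of cτ + d forces c = 0 and d = ±1; then γ is a translation, and fixing τ makes
it trivial up to sign. -/
theorem mem_center_of_denom_sq_eq_one {γ : SL(2, ℤ)} {τ : ℍ} (hγ : γ • τ = τ)
    (hd : denom γ τ ^ 2 = 1) : γ ∈ Subgroup.center SL(2, ℤ) := by
  have hden := denom_int_apply γ τ
  have key : ∀ e : ℤ, (γ 1 0 : ℂ) * τ + (γ 1 1 : ℂ) = e → γ 1 0 = 0 ∧ γ 1 1 = e := by
    intro e he
    have him := congrArg Complex.im he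
    simp at him
    have h0 : γ 1 0 = 0 := him.resolve_right τ.im_ne_zero
    refine ⟨h0, ?_⟩
    rw [h0] at he
    simpa using he
  have hdet := γ.det_coe
  rw [Matrix.det_fin_two] at hdet
  have hsm := congrArg UpperHalfPlane.coe hγ
  rw [coe_specialLinearGroup_apply] at hsm
  simp only [algebraMap_int_eq, eq_intCast, Complex.ofReal_intCast] at hsm
  have hcase : ∃ e : ℤ, e * e = 1 ∧ γ 1 0 = 0 ∧ γ 1 1 = e := by
    rcases mul_self_eq_one_iff.mp ((sq _).symm.trans hd) with h | h
    · exact ⟨1, by norm_num, key 1 (by rw [← hden, h]; simp)⟩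
    · exact ⟨-1, by norm_num, key (-1) (by rw [← hden, h]; simp)⟩
  obtain ⟨e, he, hc, hd'⟩ := hcase
  rw [hc, hd'] at hdet
  have ha : γ 0 0 = e := by linear_combination e * hdet - γ 0 0 * he
  have hb : γ 0 1 = 0 := by
    rw [hc, hd', ha] at hsm
    have he0 : (e : ℂ) ≠ 0 := by
      intro h
      have : e = 0 := by exact_mod_cast h
      simp [this] at he
    rw [Int.cast_zero, zero_mul, zero_add, div_eq_iff he0] at hsm
    have : (γ 0 1 : ℂ) = 0 := by linear_combination hsm
    exact_mod_cast this
  rw [Matrix.SpecialLinearGroup.mem_center_iff]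
  refine ⟨e, by simpa [sq] using he, ?_⟩
  ext i j
  rw [Matrix.scalar_apply, Matrix.diagonal_apply]
  fin_cases i <;> fin_cases j <;> simp [ha, hb, hc, hd']

/-- The squared factor is insensitive to the sign of the representative and multiplicative on the
stabilizer, so injectivity reduces to its trivial kernel. -/
theorem injective_denom_sq (τ : ℍ) :
    Function.Injective (fun p : MulAction.stabilizer PSL(2, ℤ) τ =>
      denom (Quotient.out p.1 : SL(2, ℤ)) τ ^ 2) := by
  intro p₁ p₂ h
  have hstab : ∀ p : MulAction.stabilizer PSL(2, ℤ) τ, (Quotient.out p.1 : SL(2, ℤ)) • τ = τ := by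
    intro p
    have := p.2
    rw [MulAction.mem_stabilizer_iff] at this
    rw [← psl_mk_smul]
    have h2 : (QuotientGroup.mk (Quotient.out p.1) : PSL(2, ℤ)) = p.1 := Quotient.out_eq p.1
    rw [h2, this]
  set g₁ : SL(2, ℤ) := Quotient.out p₁.1 with hg₁
  set g₂ : SL(2, ℤ) := Quotient.out p₂.1 with hg₂
  have h1 : (g₁⁻¹ * g₂) • τ = τ := by
    rw [mul_smul, hg₂, hstab p₂, inv_smul_eq_iff, hg₁, hstab p₁]
  have h2 := denom_mul_int g₁ (g₁⁻¹ * g₂) τ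
  rw [h1, mul_inv_cancel_left] at h2
  have h3 : denom (g₁⁻¹ * g₂ : SL(2, ℤ)) τ ^ 2 = 1 := by
    have h4 : denom g₁ τ ^ 2 ≠ 0 := pow_ne_zero _ (denom_ne_zero _ _)
    have h5 : denom g₁ τ ^ 2 = denom g₂ τ ^ 2 := h
    rw [h2, mul_pow] at h5
    exact (mul_eq_left₀ h4).mp h5.symm
  have h4 : (QuotientGroup.mk g₁ : PSL(2, ℤ)) = QuotientGroup.mk g₂ :=
    QuotientGroup.eq.mpr (mem_center_of_denom_sq_eq_one h1 h3)
  refine Subtype.ext ?_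
  calc p₁.1 = QuotientGroup.mk g₁ := (Quotient.out_eq p₁.1).symm
    _ = QuotientGroup.mk g₂ := h4
    _ = p₂.1 := Quotient.out_eq p₂.1

theorem mem_stabilizer_mk_iff {γ : SL(2, ℤ)} {τ : ℍ} :
    (QuotientGroup.mk γ : PSL(2, ℤ)) ∈ MulAction.stabilizer PSL(2, ℤ) τ ↔ γ • τ = τ :=
  Iff.rfl

theorem denom_out_pow_eq_one {τ : ℍ} (p : MulAction.stabilizer PSL(2, ℤ) τ) :
    (denom (Quotient.out p.1 : SL(2, ℤ)) τ ^ 2) ^ (jRam τ).toNat = 1 := by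
  have h : (Quotient.out p.1 : SL(2, ℤ)) • τ = τ := by
    rw [← mem_stabilizer_mk_iff]
    have h2 : (QuotientGroup.mk (Quotient.out p.1) : PSL(2, ℤ)) = p.1 := Quotient.out_eq p.1
    rw [h2]
    exact p.2
  have h1 := denom_pow_eq_one h
  rw [← Int.toNat_of_nonneg (jRam_pos τ).le] at h1
  exact_mod_cast h1

theorem exists_injective_rootsOfUnity (τ : ℍ) :
    ∃ F : MulAction.stabilizer PSL(2, ℤ) τ → rootsOfUnity (jRam τ).toNat ℂ,
      Function.Injective F := by
  have : NeZero (jRam τ).toNat := ⟨by have := jRam_pos τ; omega⟩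
  refine ⟨fun p => rootsOfUnity.mkOfPowEq _ (denom_out_pow_eq_one p), fun p₁ p₂ h => ?_⟩
  refine injective_denom_sq τ ?_
  have h1 := congrArg (fun z : rootsOfUnity (jRam τ).toNat ℂ => ((z : ℂˣ) : ℂ)) h
  simpa only [rootsOfUnity.coe_mkOfPowEq] using h1

theorem finite_stabilizer (τ : ℍ) : Finite (MulAction.stabilizer PSL(2, ℤ) τ) := by
  obtain ⟨F, hF⟩ := exists_injective_rootsOfUnity τ
  have : NeZero (jRam τ).toNat := ⟨by have := jRam_pos τ; omega⟩
  exact Finite.of_injective F hF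

theorem card_stabilizer_le (τ : ℍ) :
    (Nat.card (MulAction.stabilizer PSL(2, ℤ) τ) : ℤ) ≤ jRam τ := by
  obtain ⟨F, hF⟩ := exists_injective_rootsOfUnity τ
  have : NeZero (jRam τ).toNat := ⟨by have := jRam_pos τ; omega⟩
  have h := Nat.card_le_card_of_injective F hF
  rw [Complex.card_rootsOfUnity] at h
  have := jRam_pos τ
  omega

theorem S_smul_I : ModularGroup.S • I = I := ModularGroup.stabilizer_I.mpr (by simp)

theorem ST_smul_ρ : (ModularGroup.S * ModularGroup.T) • ρ = ρ :=
  ModularGroup.stabilizer_ρ.mpr (by simp)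

/-- The squared factor of `S` at i is -1, which is not 1. -/
theorem two_le_jRam_I : 2 ≤ jRam I := by
  have h := denom_pow_eq_one S_smul_I
  rw [denom_int_apply] at h
  simp [ModularGroup.S] at h
  by_contra hlt
  have h1 : jRam I = 1 := by have := jRam_pos I; omega
  rw [h1] at h
  norm_num at h

theorem three_le_jRam_ρ : 3 ≤ jRam ρ := by
  have h := denom_pow_eq_one ST_smul_ρ
  -- The squared factor (ρ + 1)² equals ρ, a primitive cube root of unity.
  have h0 : denom (ModularGroup.S * ModularGroup.T : SL(2, ℤ)) ρ ^ 2 = ρ := by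
    have h1 : (ModularGroup.S * ModularGroup.T) 1 0 = 1 := by decide
    have h2 : (ModularGroup.S * ModularGroup.T) 1 1 = 1 := by decide
    rw [denom_int_apply, h1, h2]
    push_cast
    linear_combination ρ_sq
  rw [h0] at h
  have hre : (ρ : ℂ) ≠ 1 := by
    intro h
    have := congrArg Complex.im h
    simp at this
    exact ρ.im_ne_zero this
  by_contra hlt
  have h1 : jRam ρ = 1 ∨ jRam ρ = 2 := by have := jRam_pos ρ; omega
  rcases h1 with h1 | h1
  · rw [h1] at h
    exact hre (by simpa using h)
  · rw [h1] at h
    have h2 : (ρ : ℂ) ^ 2 = 1 := by exact_mod_cast h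
    rw [ρ_sq] at h2
    have := congrArg Complex.im h2
    simp at this
    exact ρ.im_ne_zero this

theorem levelOneMk_I_ne_ρ : levelOneMk I ≠ levelOneMk ρ := by
  intro h
  obtain ⟨γ, hγ⟩ := levelOneMk_eq_iff.mp h.symm
  have h1 := ModularGroup.cases_of_mem_fd_smul_mem_fd ModularGroup.I_mem_fd
    (hγ.symm ▸ ModularGroup.ρ_mem_fd)
  have h2 : γ • I = I := by
    rw [ModularGroup.stabilizer_I]
    norm_num [UpperHalfPlane.ext_iff, Complex.ext_iff, ρ] at h1
    grind
  have h3 := congrArg UpperHalfPlane.re (h2.symm.trans hγ)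
  norm_num [ρ] at h3

/-- A `finsum` with infinite support is 0 by convention, so a nonzero value guarantees finite
support. -/
theorem sum_le_finsum_of_ne_zero {α : Type*} {F : α → ℚ} (h0 : ∀ a, 0 ≤ F a)
    (hF : ∑ᶠ a, F a ≠ 0) (s : Finset α) : ∑ a ∈ s, F a ≤ ∑ᶠ a, F a := by
  classical
  have hfin : (Function.support F).Finite := by
    by_contra h
    exact hF (finsum_of_infinite_support h)
  rw [finsum_eq_sum_of_support_subset (s := s ∪ hfin.toFinset) F (by simp)]
  exact Finset.sum_le_sum_of_subset_of_nonneg Finset.subset_union_left fun a _ _ => h0 a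

/-- The nonnegative terms 6 - 6/e add up to 7, while i contributes at least 3 and ρ at least 4;
nothing is left for other orbits. -/
theorem jRam_eq_ite (τ : ℍ) [Decidable (levelOneMk τ = levelOneMk I)]
    [Decidable (levelOneMk τ = levelOneMk ρ)] :
    jRam τ = if levelOneMk τ = levelOneMk I then 2 else if levelOneMk τ = levelOneMk ρ then 3
      else 1 := by
  classical
  set F : LevelOneOrbit → ℚ := fun y => (6 * (jRam y.out - 1) : ℚ) / jRam y.out with hF
  have hpos : ∀ τ, (1 : ℚ) ≤ jRam τ := fun τ => by exact_mod_cast jRam_pos τ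
  have hF0 : ∀ y, 0 ≤ F y := fun y =>
    div_nonneg (by linarith [hpos y.out]) (by linarith [hpos y.out])
  have hsum := sum_le_finsum_of_ne_zero hF0 (by rw [finsum_jRam]; norm_num)
  rw [finsum_jRam] at hsum
  have hFmk : ∀ τ, F (levelOneMk τ) = 6 - 6 / jRam τ := fun τ => by
    have := hpos τ
    simp only [hF]
    rw [eq_out_of_smul_invariant jRam_smul]
    field_simp
  have hI : (2 : ℚ) ≤ jRam I := by exact_mod_cast two_le_jRam_I
  have hρ : (3 : ℚ) ≤ jRam ρ := by exact_mod_cast three_le_jRam_ρ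
  have hFI : 3 ≤ F (levelOneMk I) := by
    rw [hFmk, le_sub_comm, div_le_iff₀ (by linarith)]
    linarith
  have hFρ : 4 ≤ F (levelOneMk ρ) := by
    rw [hFmk, le_sub_comm, div_le_iff₀ (by linarith)]
    linarith
  have h2 := hsum {levelOneMk I, levelOneMk ρ}
  rw [Finset.sum_pair levelOneMk_I_ne_ρ] at h2
  have hmk : ∀ τ τ', levelOneMk τ = levelOneMk τ' → jRam τ = jRam τ' := fun τ τ' h => by
    rw [← eq_out_of_smul_invariant jRam_smul τ, h, eq_out_of_smul_invariant jRam_smul]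
  split_ifs with h h'
  · rw [hmk τ I h]
    have h3 : F (levelOneMk I) = 3 := by linarith
    rw [hFmk] at h3
    field_simp at h3
    have : (jRam I : ℚ) = 2 := by linarith
    exact_mod_cast this
  · rw [hmk τ ρ h']
    have h3 : F (levelOneMk ρ) = 4 := by linarith
    rw [hFmk] at h3
    field_simp at h3
    have : (jRam ρ : ℚ) = 3 := by linarith
    exact_mod_cast this
  · have h3 := hsum {levelOneMk τ, levelOneMk I, levelOneMk ρ}
    rw [Finset.sum_insert (by simp [h, h']), Finset.sum_pair levelOneMk_I_ne_ρ] at h3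
    have h4 : F (levelOneMk τ) = 0 := le_antisymm (by linarith) (hF0 _)
    rw [hFmk] at h4
    have := hpos τ
    field_simp at h4
    have : (jRam τ : ℚ) = 1 := by linarith
    exact_mod_cast this

/-- A nonzero lower-left entry makes γ noncentral, so its image in PSL(2, ℤ) has order exactly p. -/
theorem dvd_card_stabilizer {γ : SL(2, ℤ)} {τ : ℍ} (hγ : γ • τ = τ) {p : ℕ} [Fact p.Prime]
    (hp : γ ^ p ∈ Subgroup.center SL(2, ℤ)) (hne : γ 1 0 ≠ 0) :
    p ∣ Nat.card (MulAction.stabilizer PSL(2, ℤ) τ) := by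
  set x : MulAction.stabilizer PSL(2, ℤ) τ := ⟨QuotientGroup.mk γ, mem_stabilizer_mk_iff.mpr hγ⟩
  have h1 : x ^ p = 1 := Subtype.ext ((QuotientGroup.eq_one_iff (γ ^ p)).mpr hp)
  have h2 : x ≠ 1 := by
    intro h
    have h3 : γ ∈ Subgroup.center SL(2, ℤ) :=
      (QuotientGroup.eq_one_iff γ).mp (congrArg Subtype.val h)
    obtain ⟨r, -, hr⟩ := Matrix.SpecialLinearGroup.mem_center_iff.mp h3
    refine hne ?_
    rw [← hr, Matrix.scalar_apply, Matrix.diagonal_apply_ne _ (by decide)]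
  rw [← orderOf_eq_prime h1 h2]
  exact orderOf_dvd_natCard x

theorem neg_one_mem_center : (-1 : SL(2, ℤ)) ∈ Subgroup.center SL(2, ℤ) :=
  Subgroup.mem_center_iff.mpr fun g => by simp

theorem card_stabilizer_smul (γ : SL(2, ℤ)) (τ : ℍ) :
    Nat.card (MulAction.stabilizer PSL(2, ℤ) (γ • τ))
      = Nat.card (MulAction.stabilizer PSL(2, ℤ) τ) :=
  (Nat.card_congr (MulAction.stabilizerEquivStabilizer
    (psl_mk_smul γ τ).symm).toEquiv).symm

/-- The ramification index of `j` at `τ` is the order of the stabilizer of `τ`. -/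
theorem jRam_eq_card_stabilizer (τ : ℍ) :
    jRam τ = Nat.card (MulAction.stabilizer PSL(2, ℤ) τ) := by
  classical
  have hle := card_stabilizer_le τ
  have hfin := finite_stabilizer τ
  have hpos : 0 < Nat.card (MulAction.stabilizer PSL(2, ℤ) τ) := Nat.card_pos
  have hmk : ∀ τ', levelOneMk τ = levelOneMk τ' →
      Nat.card (MulAction.stabilizer PSL(2, ℤ) τ)
        = Nat.card (MulAction.stabilizer PSL(2, ℤ) τ') := fun τ' h => by
    have h1 := eq_out_of_smul_invariant
      (F := fun τ => Nat.card (MulAction.stabilizer PSL(2, ℤ) τ)) card_stabilizer_smul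
    exact (h1 τ).symm.trans (h ▸ h1 τ')
  -- The upper bound is now 2, 3 or 1, and it is attained thanks to the elements `S` and `S * T` of
  -- order 2 and 3.
  rw [jRam_eq_ite] at hle ⊢
  split_ifs at hle ⊢ with h h'
  · have h2 : 2 ∣ Nat.card (MulAction.stabilizer PSL(2, ℤ) τ) := by
      rw [hmk I h]
      refine dvd_card_stabilizer S_smul_I ?_ (by simp [ModularGroup.S])
      have : ModularGroup.S ^ 2 = -1 := by decide
      rw [this]
      exact neg_one_mem_center
    have := Nat.le_of_dvd hpos h2
    omega
  · have h2 : 3 ∣ Nat.card (MulAction.stabilizer PSL(2, ℤ) τ) := by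
      rw [hmk ρ h']
      refine dvd_card_stabilizer ST_smul_ρ ?_ (by decide)
      have : (ModularGroup.S * ModularGroup.T) ^ 3 = -1 := by decide
      rw [this]
      exact neg_one_mem_center
    have := Nat.le_of_dvd hpos h2
    omega
  · omega

/-- The valence formula for meromorphic functions on `PSL(2, ℤ) \ ℍ`. -/
theorem levelOne_valence {h : ℍ → ℂ} (hm : IsMeromorphic h)
    (hinv : ∀ γ : SL(2, ℤ), (fun τ => h (γ • τ)) =ᶠ[codiscrete ℍ] h) {r : ℚ}
    (hr : CuspOrder h r) :
    r + ∑ᶠ y : LevelOneOrbit, ((ordAt h y.out).untop₀ : ℚ)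
      / Nat.card (MulAction.stabilizer PSL(2, ℤ) y.out) = 0 := by
  have := levelOne_valence_jRam hm hinv hr
  simpa only [jRam_eq_card_stabilizer, Int.cast_natCast] using this

end Ramification

/-! ### Counting orbits of a subgroup of finite index -/

section OrbitCounting

variable {Γ X : Type*} [Group Γ] [MulAction Γ X] (H : Subgroup Γ)

/-- The number of cosets `H g` with `g x₀ ∈ H x₁` is the index of the stabilizer of `x₁` in `H`
in the stabilizer of `x₁`. -/
theorem card_coset_mul_card_stabilizer {γ : Quotient (QuotientGroup.rightRel H) → Γ}
    (hγ : ∀ c, Quotient.mk _ (γ c) = c) {x₀ x₁ : X} (h : ∃ g : Γ, g • x₀ = x₁) :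
    Nat.card {c // ∃ h ∈ H, h • γ c • x₀ = x₁} * Nat.card (MulAction.stabilizer H x₁)
      = Nat.card (MulAction.stabilizer Γ x₁) := by
  obtain ⟨g, hg⟩ := h
  have hg' : g⁻¹ • x₁ = x₀ := by rw [← hg, inv_smul_smul]
  -- The bijection sends (c, h) to h t_c γ_c g⁻¹, where t_c ∈ H carries γ_c x₀ to x₁.
  choose t htH ht using fun c : {c // ∃ h ∈ H, h • γ c • x₀ = x₁} => c.2
  rw [← Nat.card_prod]
  refine Nat.card_congr (Equiv.ofBijective 
    (fun p => ⟨(p.2.1 : Γ) * t p.1 * γ p.1 * g⁻¹, ?_⟩) ⟨?_, ?_⟩)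
  · rw [MulAction.mem_stabilizer_iff, mul_smul, mul_smul, mul_smul, hg', ht]
    exact p.2.2
  · rintro ⟨c, h⟩ ⟨c', h'⟩ heq
    have h1 : (h.1 : Γ) * t c * γ c = h'.1 * t c' * γ c' :=
      mul_right_cancel (congrArg Subtype.val heq)
    have hc : c = c' := by
      refine Subtype.ext ?_
      rw [← hγ c, ← hγ c']
      refine Quotient.sound (QuotientGroup.rightRel_apply.mpr ?_)
      have h2 : γ c' * (γ c)⁻¹ = (h'.1 * t c')⁻¹ * (h.1 * t c) := by
        rw [mul_inv_eq_iff_eq_mul, mul_assoc, h1, inv_mul_cancel_left]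
      rw [h2]
      exact H.mul_mem (H.inv_mem (H.mul_mem h'.1.2 (htH _))) (H.mul_mem h.1.2 (htH _))
    subst hc
    have h3 : (h.1 : Γ) = h'.1 := mul_right_cancel (mul_right_cancel h1)
    exact Prod.ext rfl (Subtype.ext (Subtype.ext h3))
  · rintro ⟨s, hs⟩
    have hs' : s • x₁ = x₁ := hs
    set c : Quotient (QuotientGroup.rightRel H) := Quotient.mk _ (s * g) with hc
    have h1 : s * g * (γ c)⁻¹ ∈ H := by
      rw [← QuotientGroup.rightRel_apply]
      exact Quotient.exact (hγ c)
    have h2 : (s * g * (γ c)⁻¹) • γ c • x₀ = x₁ := by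
      rw [← mul_smul, inv_mul_cancel_right, mul_smul, hg, hs']
    set c' : {c // ∃ h ∈ H, h • γ c • x₀ = x₁} := ⟨c, _, h1, h2⟩
    have h3 : s * g * (γ c)⁻¹ * (t c')⁻¹ ∈ H := H.mul_mem h1 (H.inv_mem (htH c'))
    refine ⟨⟨c', ⟨⟨_, h3⟩, ?_⟩⟩, ?_⟩
    · change (s * g * (γ c)⁻¹ * (t c')⁻¹) • x₁ = x₁
      conv_lhs => rw [← ht c']
      rw [mul_smul, inv_smul_smul]
      exact h2
    · refine Subtype.ext ?_
      change s * g * (γ c)⁻¹ * (t c')⁻¹ * t c' * γ c * g⁻¹ = s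
      group

/-- A Γ-orbit splits into H-orbits, and the H-orbit of x is hit by |Γ_x|/|H_x| of the cosets. Hence
summing over cosets with weight 1/|Γ_x| equals summing over H-orbits with weight 1/|H_x|. -/
theorem finsum_orbit_subgroup [Fintype (Quotient (QuotientGroup.rightRel H))]
    {γ : Quotient (QuotientGroup.rightRel H) → Γ} (hγ : ∀ c, Quotient.mk _ (γ c) = c)
    {ρ : MulAction.orbitRel.Quotient H X → X} (hρ : ∀ x, Quotient.mk _ (ρ x) = x)
    {F : X → ℚ} (hF : ∀ h ∈ H, ∀ x, F (h • x) = F x)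
    (hfin : ∀ x : X, Finite (MulAction.stabilizer Γ x)) (hsupp : {x | F (ρ x) ≠ 0}.Finite) :
    ∑ᶠ x, (1 : ℚ) / (Nat.card (MulAction.stabilizer H (ρ x)) : ℚ) * F (ρ x)
      = ∑ᶠ y : MulAction.orbitRel.Quotient Γ X,
          (∑ c, F (γ c • y.out)) / Nat.card (MulAction.stabilizer Γ y.out) := by
  classical
  let pr : MulAction.orbitRel.Quotient H X → MulAction.orbitRel.Quotient Γ X :=
    fun x => Quotient.mk _ (ρ x)
  let π : Quotient (QuotientGroup.rightRel H) → MulAction.orbitRel.Quotient Γ X →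
    MulAction.orbitRel.Quotient H X := fun c y => Quotient.mk _ (γ c • y.out)
  have hπ : ∀ c y x, π c y = x ↔ ∃ h ∈ H, h • γ c • y.out = ρ x := by
    intro c y x
    rw [← hρ x, eq_comm, Quotient.eq, MulAction.orbitRel_apply, MulAction.mem_orbit_iff, hρ x]
    exact ⟨fun ⟨h, hh⟩ => ⟨h, h.2, hh⟩, fun ⟨h, hH, hh⟩ => ⟨⟨h, hH⟩, hh⟩⟩
  have hFπ : ∀ c y, F (ρ (π c y)) = F (γ c • y.out) := by
    intro c y
    obtain ⟨h, hH, hh⟩ := (hπ c y _).mp rfl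
    rw [← hh, hF h hH]
  have hpr : ∀ y x, pr x = y → ∃ g : Γ, g • y.out = ρ x := by
    rintro y x rfl
    have : (Quotient.mk _ (ρ x) : MulAction.orbitRel.Quotient Γ X)
      = Quotient.mk _ (pr x).out := (Quotient.out_eq (pr x)).symm
    exact MulAction.orbitRel_apply.mp (Quotient.exact this)
  have hprπ : ∀ c y, pr (π c y) = y := by
    intro c y
    obtain ⟨h, -, hh⟩ := (hπ c y _).mp rfl
    rw [← Quotient.out_eq y]
    refine Quotient.sound (MulAction.orbitRel_apply.mpr ⟨h * γ c, ?_⟩)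
    rw [Quotient.out_eq]
    exact (mul_smul _ _ _).trans hh
  set S : Finset (MulAction.orbitRel.Quotient H X) := hsupp.toFinset with hS
  have hmemS : ∀ x, x ∉ S → F (ρ x) = 0 := fun x hx => by
    by_contra h
    exact hx ((Set.Finite.mem_toFinset _).mpr h)
  rw [finsum_eq_sum_of_support_subset (s := S) _ (fun x hx => by
    by_contra h
    refine hx ?_
    simp only
    rw [hmemS x h, mul_zero])]
  rw [finsum_eq_sum_of_support_subset (s := S.image pr) _ (fun y hy => by
    by_contra h
    refine hy ?_
    simp only
    rw [Finset.sum_eq_zero, zero_div]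
    intro c _
    rw [← hFπ]
    refine hmemS _ fun hc => h ?_
    exact Finset.mem_coe.mpr (Finset.mem_image.mpr ⟨_, hc, hprπ c y⟩))]
  rw [← Finset.sum_fiberwise_of_maps_to (fun x hx => Finset.mem_image_of_mem pr hx)]
  refine Finset.sum_congr rfl fun y _ => ?_
  -- The term of an H-orbit is spread evenly over the cosets that lead to it, after which the two
  -- sums can be exchanged.
  have hx : ∀ x ∈ S.filter (fun x => pr x = y),
      (1 : ℚ) / (Nat.card (MulAction.stabilizer H (ρ x)) : ℚ) * F (ρ x)
      = ∑ c, if π c y = x then F (γ c • y.out) / Nat.card (MulAction.stabilizer Γ y.out) else 0 := by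
    intro x hx
    obtain ⟨g, hg⟩ := hpr y x (Finset.mem_filter.mp hx).2
    have h1 := card_coset_mul_card_stabilizer H hγ ⟨g, hg⟩
    have h2 : Nat.card (MulAction.stabilizer Γ (ρ x)) = Nat.card (MulAction.stabilizer Γ y.out) :=
      (Nat.card_congr (MulAction.stabilizerEquivStabilizer hg.symm).toEquiv).symm
    have h3 : Nat.card {c // ∃ h ∈ H, h • γ c • y.out = ρ x}
        = (Finset.univ.filter fun c => π c y = x).card := by
      rw [Nat.card_eq_fintype_card, Fintype.card_subtype]
      simp only [hπ]
    have h4 : ∀ c, (if π c y = x then F (γ c • y.out) / Nat.card (MulAction.stabilizer Γ y.out)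
        else 0) = if π c y = x then F (ρ x) / Nat.card (MulAction.stabilizer Γ y.out) else 0 := by
      intro c
      split_ifs with h
      · rw [← hFπ, h]
      · rfl
    rw [Finset.sum_congr rfl fun c _ => h4 c, ← Finset.sum_filter, Finset.sum_const, nsmul_eq_mul,
      ← h3, ← h2, ← h1]
    have hpos := (hfin (ρ x))
    have h5 : Nat.card (MulAction.stabilizer Γ (ρ x)) ≠ 0 := Nat.card_pos.ne'
    rw [← h1] at h5
    have h6 : (Nat.card {c // ∃ h ∈ H, h • γ c • y.out = ρ x} : ℚ) ≠ 0 := by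
      exact_mod_cast left_ne_zero_of_mul h5
    have h7 : (Nat.card (MulAction.stabilizer H (ρ x)) : ℚ) ≠ 0 := by
      exact_mod_cast right_ne_zero_of_mul h5
    push_cast
    field_simp
  rw [Finset.sum_congr rfl hx, Finset.sum_comm, Finset.sum_div]
  refine Finset.sum_congr rfl fun c _ => ?_
  rw [Finset.sum_ite_eq]
  split_ifs with h
  · rfl
  · rw [← hFπ, hmemS, zero_div]
    exact fun hc => h (Finset.mem_filter.mpr ⟨hc, hprπ c y⟩)

end OrbitCounting

/-! ### The valence formula for functions invariant under a subgroup of finite index -/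

section WeightZero

theorem eventually_codiscrete_psl_smul {P : ℍ → Prop} (h : ∀ᶠ τ in codiscrete ℍ, P τ)
    (p : PSL(2, ℤ)) : ∀ᶠ τ in codiscrete ℍ, P (p • τ) := by
  obtain ⟨γ, rfl⟩ := QuotientGroup.mk_surjective p
  exact eventually_codiscrete_smul h γ

theorem IsMeromorphic.comp_psl_smul {f : ℍ → ℂ} (hf : IsMeromorphic f) (p : PSL(2, ℤ)) :
    IsMeromorphic (fun τ => f (p • τ)) := by
  obtain ⟨γ, rfl⟩ := QuotientGroup.mk_surjective p
  exact hf.comp_smul γ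

theorem ordAt_comp_psl_smul (f : ℍ → ℂ) (p : PSL(2, ℤ)) (τ : ℍ) :
    ordAt (fun τ => f (p • τ)) τ = ordAt f (p • τ) := by
  obtain ⟨γ, rfl⟩ := QuotientGroup.mk_surjective p
  exact ordAt_comp_smul f γ τ

variable {H : Subgroup PSL(2, ℤ)} {ψ : ℍ → ℂ}
  {γ : Quotient (QuotientGroup.rightRel H) → PSL(2, ℤ)}

theorem mul_inv_mem_of_coset_eq (hγ : ∀ c, Quotient.mk _ (γ c) = c) (p : PSL(2, ℤ)) :
    γ (Quotient.mk _ p) * p⁻¹ ∈ H := by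
  rw [← QuotientGroup.rightRel_apply]
  exact Quotient.exact (hγ (Quotient.mk _ p)).symm

theorem ordAt_smul_of_mem (hψ : ∀ p ∈ H, (fun τ => ψ (p • τ)) =ᶠ[codiscrete ℍ] ψ)
    {p : PSL(2, ℤ)} (hp : p ∈ H) (τ : ℍ) : ordAt ψ (p • τ) = ordAt ψ τ := by
  rw [← ordAt_comp_psl_smul, ordAt_congr (hψ p hp)]

variable [Fintype (Quotient (QuotientGroup.rightRel H))]

/-- The product of the translates of `ψ` is invariant under `PSL(2, ℤ)`. -/
theorem prod_smul_invariant (hγ : ∀ c, Quotient.mk _ (γ c) = c)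
    (hψ : ∀ p ∈ H, (fun τ => ψ (p • τ)) =ᶠ[codiscrete ℍ] ψ) (δ : PSL(2, ℤ)) :
    (fun τ => ∏ c, ψ (γ c • δ • τ)) =ᶠ[codiscrete ℍ] fun τ => ∏ c, ψ (γ c • τ) := by
  -- Right multiplication by δ permutes the cosets; γ_c δ and the chosen representative of its coset
  -- differ by an element of H, which ψ does not see.
  let σ : Quotient (QuotientGroup.rightRel H) → Quotient (QuotientGroup.rightRel H) :=
    fun c => Quotient.mk _ (γ c * δ)
  have hσ : Function.Injective σ := by
    intro c c' h
    have h1 := QuotientGroup.rightRel_apply.mp (Quotient.exact h)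
    rw [← hγ c, ← hγ c']
    refine Quotient.sound (QuotientGroup.rightRel_apply.mpr ?_)
    simpa [mul_assoc] using h1
  have hev : ∀ᶠ τ in codiscrete ℍ, ∀ c, ψ (γ c • δ • τ) = ψ (γ (σ c) • τ) := by
    refine eventually_all.mpr fun c => ?_
    filter_upwards [eventually_codiscrete_psl_smul
      (hψ _ (mul_inv_mem_of_coset_eq hγ (γ c * δ))) (γ c * δ)] with τ hτ
    rw [← mul_smul, inv_mul_cancel_right] at hτ
    rw [← mul_smul]
    exact hτ.symm
  filter_upwards [hev] with τ hτ
  rw [Finset.prod_congr rfl fun c _ => hτ c]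
  exact (Finite.injective_iff_bijective.mp hσ).prod_comp fun c => ψ (γ c • τ)

/-- Every orbit has a point γ_c τ with τ in the standard fundamental domain, and the order at the
cusp of c bounds the height of τ when ψ has a zero or pole there. -/
theorem finite_orbits_ordAt_ne_zero (hm : IsMeromorphic ψ)
    (hψ : ∀ p ∈ H, (fun τ => ψ (p • τ)) =ᶠ[codiscrete ℍ] ψ)
    (hγ : ∀ c, Quotient.mk _ (γ c) = c) {r : Quotient (QuotientGroup.rightRel H) → ℚ}
    (hr : ∀ c, CuspOrder (fun τ => ψ (γ c • τ)) (r c))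
    {ρ : MulAction.orbitRel.Quotient H ℍ → ℍ} (hρ : ∀ x, Quotient.mk _ (ρ x) = x) :
    {x | ordAt ψ (ρ x) ≠ 0}.Finite := by
  have hmc := fun c => hm.comp_psl_smul (γ c)
  choose A hA using fun c => (hr c).exists_ordAt_eq_zero (hmc c)
  have hfin := fun c => finite_inter_of_eventually_notMem
    (S := {τ | ordAt (fun τ => ψ (γ c • τ)) τ ≠ 0}) (isCompact_rectangle (A c))
    (fun τ => by simpa using (hmc c).eventually_ordAt_eq_zero ((hr c).ordAt_ne_top (hmc c)) τ)
  refine (Set.finite_iUnion fun c => (hfin c).image fun τ =>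
    (Quotient.mk _ (γ c • τ) : MulAction.orbitRel.Quotient H ℍ)).subset fun x hx => ?_
  obtain ⟨g, hg⟩ := ModularGroup.exists_smul_mem_fd (ρ x)
  let p : PSL(2, ℤ) := (QuotientGroup.mk g)⁻¹
  have hp : p • g • ρ x = ρ x := by
    rw [← psl_mk_smul, inv_smul_smul]
  have hmem := mul_inv_mem_of_coset_eq hγ p
  have hsm : γ (Quotient.mk _ p) • g • ρ x = (γ (Quotient.mk _ p) * p⁻¹) • ρ x := by
    conv_rhs => rw [← hp]
    rw [← mul_smul _ p, inv_mul_cancel_right]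
  have hord : ordAt (fun τ => ψ (γ (Quotient.mk _ p) • τ)) (g • ρ x) ≠ 0 := by
    rw [ordAt_comp_psl_smul, hsm, ordAt_smul_of_mem hψ hmem]
    exact hx
  refine Set.mem_iUnion.mpr ⟨Quotient.mk _ p, g • ρ x, ⟨⟨hg.2, ?_, ?_⟩, hord⟩, ?_⟩
  · have h1 := ModularGroup.three_le_four_mul_im_sq_of_mem_fd hg
    have h2 := (g • ρ x).im_pos
    nlinarith
  · by_contra hlt
    exact hord (hA _ _ (not_le.mp hlt))
  · simp only
    rw [hsm]
    refine Eq.trans (Quotient.sound (MulAction.orbitRel_apply.mpr ⟨⟨_, hmem⟩, rfl⟩)) (hρ x)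

/-- The level-one formula is applied to the product of the translates of ψ, and its orbit sum is
regrouped into H-orbits. -/
theorem valence_weight_zero (hm : IsMeromorphic ψ) (hne : ∀ τ, ordAt ψ τ ≠ ⊤)
    (hψ : ∀ p ∈ H, (fun τ => ψ (p • τ)) =ᶠ[codiscrete ℍ] ψ)
    (hγ : ∀ c, Quotient.mk _ (γ c) = c) {r : Quotient (QuotientGroup.rightRel H) → ℚ}
    (hr : ∀ c, CuspOrder (fun τ => ψ (γ c • τ)) (r c))
    {ρ : MulAction.orbitRel.Quotient H ℍ → ℍ} (hρ : ∀ x, Quotient.mk _ (ρ x) = x) :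
    ∑ c, r c + ∑ᶠ x, (1 : ℚ) / (Nat.card (MulAction.stabilizer H (ρ x)) : ℚ)
      * ((ordAt ψ (ρ x)).untop₀ : ℚ) = 0 := by
  have hmc := fun c => hm.comp_psl_smul (γ c)
  have hval := levelOne_valence (h := fun τ => ∏ c, ψ (γ c • τ))
    (IsMeromorphic.prod fun c _ => hmc c) (fun δ => prod_smul_invariant hγ hψ (QuotientGroup.mk δ))
    (CuspOrder.prod fun c _ => hr c)
  have hord : ∀ τ, ((ordAt (fun τ => ∏ c, ψ (γ c • τ)) τ).untop₀ : ℚ)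
      = ∑ c, ((ordAt ψ (γ c • τ)).untop₀ : ℚ) := by
    intro τ
    rw [ordAt_prod fun c _ => hmc c]
    have h1 : ∀ c, ordAt (fun τ => ψ (γ c • τ)) τ
        = (((ordAt ψ (γ c • τ)).untop₀ : ℤ) : WithTop ℤ) := fun c => by
      rw [ordAt_comp_psl_smul, WithTop.coe_untop₀_of_ne_top (hne _)]
    rw [Finset.sum_congr rfl fun c _ => h1 c, ← WithTop.coe_sum, WithTop.untop₀_coe]
    push_cast
    rfl
  have hcount := finsum_orbit_subgroup H hγ hρ (F := fun τ => ((ordAt ψ τ).untop₀ : ℚ))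
    (fun p hp τ => by rw [ordAt_smul_of_mem hψ hp]) finite_stabilizer
    ((finite_orbits_ordAt_ne_zero hm hψ hγ hr hρ).subset fun x hx h => hx (by simp [h]))
  rw [hcount]
  simpa only [hord] using hval

end WeightZero

/-! ### Meromorphic modular forms with multiplier systems -/

section ModularForms

open ModularForm

variable {D : ℕ} {k : ℚ}

theorem ofInt_mat_smul (γ : SL(2, ℤ)) (ε : rootsOfUnity D ℂ) (τ : ℍ) :
    (DCover.ofInt γ ε).mat • τ = γ • τ := rfl

theorem slashD_ofInt_eq_zero_iff (f : ℍ → ℂ) (γ : SL(2, ℤ)) (ε : rootsOfUnity D ℂ) (τ : ℍ) :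
    slashD k f (DCover.ofInt γ ε) τ = 0 ↔ f (γ • τ) = 0 := by
  have h1 : (DCover.ofInt γ ε).epsC ≠ 0 := Units.ne_zero _
  have h2 := autFactor_ne_zero (DCover.ofInt γ ε).mat τ
  simp only [slashD, mul_eq_zero, Complex.cpow_eq_zero_iff, h1, h2, false_and, false_or,
    ofInt_mat_smul]

variable [NeZero D]

/-- Since Dk is an integer, the D-th power removes ε and the branch of the root, leaving a slash
operator of integral weight. -/
theorem slashD_pow {m : ℤ} (hk : k = (m : ℚ) / D) (f : ℍ → ℂ) (γ : SL(2, ℤ))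
    (ε : rootsOfUnity D ℂ) (τ : ℍ) :
    slashD k f (DCover.ofInt γ ε) τ ^ D = denom γ τ ^ (-m) * f (γ • τ) ^ D := by
  have hD : (D : ℂ) ≠ 0 := Nat.cast_ne_zero.mpr (NeZero.ne D)
  have hkD : (D : ℂ) * (k : ℂ) = (m : ℂ) := by
    rw [hk]
    push_cast
    field_simp
  have hε : (DCover.ofInt γ ε).epsC ^ D = 1 := (mem_rootsOfUnity' D _).mp ε.2
  rw [slashD, mul_pow, mul_pow, ofInt_mat_smul, ← Complex.cpow_nat_mul, ← Complex.cpow_nat_mul,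
    mul_neg, mul_neg, hkD]
  have h1 : (-((D : ℂ) * (m : ℂ))) = (((D : ℤ) * (-m) : ℤ) : ℂ) := by
    push_cast
    ring
  have h2 : (-(m : ℂ)) = ((-m : ℤ) : ℂ) := by push_cast; rfl
  rw [h1, h2, Complex.cpow_intCast, Complex.cpow_intCast, _root_.zpow_mul, zpow_natCast, hε,
    _root_.one_zpow, one_mul]
  rfl

/-- If all coefficients vanished, f would vanish near a point of ℍ off a discrete set, hence
everywhere by connectedness. Otherwise the exponents that occur are bounded below and have a least
element. -/
theorem hasOrdAtImInfty_slashD {G : Subgroup SL(2, ℤ)} {χ : DCover.cover D G →* ℂˣ} {f : ℍ → ℂ}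
    (hf : IsMeromorphicModularForm D k G χ f) (hf0 : ¬ f =ᶠ[codiscrete ℍ] 0) (γ : SL(2, ℤ))
    (ε : rootsOfUnity D ℂ) : ∃ r, HasOrdAtImInfty (slashD k f (DCover.ofInt γ ε)) r := by
  obtain ⟨m, hm, a, hA, N, hN⟩ := hf.meromorphic_cusps (DCover.ofInt γ ε)
    ⟨γ, Subgroup.mem_top γ, rfl⟩
  have hbdd : BddBelow {j : ℤ | a j ≠ 0} := ⟨N, fun j hj => by
    by_contra h
    exact hj (hN j (not_le.mp h))⟩
  have hne : {j : ℤ | a j ≠ 0}.Nonempty := by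
    by_contra hempty
    have h0 : ∀ j, a j = 0 := fun j => by
      by_contra h
      exact hempty ⟨j, h⟩
    obtain ⟨A, hA⟩ := hA
    let τ₀ : ℍ := ⟨((|A| + 1 : ℝ) : ℂ) * Complex.I, by simp; positivity⟩
    have him : A < τ₀.im := by
      have : τ₀.im = |A| + 1 := by
        change (((|A| + 1 : ℝ) : ℂ) * Complex.I).im = _
        simp
      rw [this]
      linarith [le_abs_self A]
    have hord : ordAt (fun τ => f (γ • τ)) τ₀ = ⊤ := by
      refine ordAt_eq_top_iff.mpr ?_
      have hopen : ∀ᶠ τ in 𝓝[≠] τ₀, A < τ.im := mem_nhdsWithin_of_mem_nhds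
        ((isOpen_lt continuous_const UpperHalfPlane.continuous_im).mem_nhds him)
      filter_upwards [hopen, eventually_codiscrete_iff.mp hA τ₀] with τ h1 h2
      have h3 := h2 h1
      simp only [h0, zero_mul] at h3
      exact (slashD_ofInt_eq_zero_iff f γ ε τ).mp (h3.unique hasSum_zero)
    rw [ordAt_comp_smul] at hord
    exact IsMeromorphic.ordAt_ne_top_of_not_eventually_zero hf.meromorphic hf0 _ hord
  exact ⟨_, m, hm, a, hA, _, ⟨Int.csInf_mem hne hbdd, fun j hj => csInf_le hbdd hj⟩, rfl⟩

theorem hasOrdAtImInfty_ordAtImInfty {g : ℍ → ℂ} (h : ∃ r, HasOrdAtImInfty g r) :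
    HasOrdAtImInfty g (ordAtImInfty g) := by
  rw [ordAtImInfty, dif_pos h]
  exact h.choose_spec

/-- The weight zero form `f ^ (12 D N) / Δ ^ (m N)` attached to a form `f` of weight `m / D`. -/
def weightZeroForm (D N : ℕ) (m : ℤ) (f : ℍ → ℂ) (τ : ℍ) : ℂ :=
  f τ ^ (12 * D * N) * discriminant τ ^ (-(m * N))

theorem weightZeroForm_smul {m : ℤ} (hk : k = (m : ℚ) / D) (N : ℕ) (f : ℍ → ℂ) (γ : SL(2, ℤ))
    (ε : rootsOfUnity D ℂ) (τ : ℍ) :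
    weightZeroForm D N m f (γ • τ)
      = slashD k f (DCover.ofInt γ ε) τ ^ (12 * D * N) * discriminant τ ^ (-(m * N)) := by
  have hd : denom γ τ ≠ 0 := denom_ne_zero _ _
  have h1 : slashD k f (DCover.ofInt γ ε) τ ^ (12 * D * N)
      = denom γ τ ^ (-(12 * (m * N))) * f (γ • τ) ^ (12 * D * N) := by
    rw [mul_comm 12 D, mul_assoc, pow_mul, slashD_pow hk, mul_pow, ← pow_mul, ← zpow_natCast,
      ← _root_.zpow_mul]
    congr 2
    push_cast
    ring
  have h2 : discriminant (γ • τ) ^ (-(m * N : ℤ))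
      = denom γ τ ^ (-(12 * (m * N) : ℤ)) * discriminant τ ^ (-(m * N : ℤ)) := by
    rw [discriminant_smul, mul_zpow, ← zpow_natCast, ← _root_.zpow_mul]
    congr 2
    push_cast
    ring
  rw [weightZeroForm, h1, h2]
  ring

theorem isMeromorphic_weightZeroForm {f : ℍ → ℂ} (hf : IsMeromorphic f) (D N : ℕ) (m : ℤ) :
    IsMeromorphic (weightZeroForm D N m f) :=
  (hf.pow _).mul ((isMeromorphic_of_mdifferentiable mdifferentiable_discriminant).zpow _)

theorem ordAt_weightZeroForm {f : ℍ → ℂ} (hf : IsMeromorphic f) (D N : ℕ) (m : ℤ) (τ : ℍ) :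
    ordAt (weightZeroForm D N m f) τ = (12 * D * N : ℕ) * ordAt f τ := by
  have hΔ := isMeromorphic_of_mdifferentiable mdifferentiable_discriminant
  change ordAt (fun τ => f τ ^ (12 * D * N) * discriminant τ ^ (-(m * N : ℤ))) τ = _
  rw [ordAt_mul (hf.pow _) (hΔ.zpow _), ordAt_pow hf, ordAt_zpow hΔ,
    ordAt_eq_zero_of_mdifferentiable mdifferentiable_discriminant (discriminant_ne_zero τ),
    mul_zero, add_zero]

/-- Every value of χ is killed by the index of its kernel, because the image of χ has that order. -/
theorem weightZeroForm_invariant {m : ℤ} (hk : k = (m : ℚ) / D) {G : Subgroup SL(2, ℤ)}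
    {χ : DCover.cover D G →* ℂˣ} {f : ℍ → ℂ} (hf : IsMeromorphicModularForm D k G χ f)
    (p : PSL(2, ℤ)) (hp : p ∈ barSubgroup G) :
    (fun τ => weightZeroForm D χ.ker.index m f (p • τ))
      =ᶠ[codiscrete ℍ] weightZeroForm D χ.ker.index m f := by
  obtain ⟨γ, hγ, rfl⟩ := hp
  let g : DCover.cover D G := ⟨DCover.ofInt γ 1, ⟨γ, hγ, rfl⟩⟩
  have hχ : χ g ^ χ.ker.index = 1 := by
    rw [← map_pow]
    exact Subgroup.pow_index_mem χ.ker g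
  have hχ' : ((χ g : ℂˣ) : ℂ) ^ χ.ker.index = 1 := by
    rw [← Units.val_pow_eq_pow_val, hχ, Units.val_one]
  filter_upwards [hf.slash_eq g] with τ hτ
  have h1 := weightZeroForm_smul hk χ.ker.index f γ 1 τ
  have hτ' : slashD k f (DCover.ofInt γ 1) τ = ((χ g : ℂˣ) : ℂ) * f τ := hτ
  refine h1.trans ?_
  rw [hτ', mul_pow, mul_comm (12 * D), pow_mul, hχ', one_pow, one_mul, weightZeroForm,
    mul_comm (12 * D)]

theorem cuspOrder_weightZeroForm {m : ℤ} (hk : k = (m : ℚ) / D) (N : ℕ) {f : ℍ → ℂ}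
    {γ : SL(2, ℤ)} {ε : rootsOfUnity D ℂ} {r : ℚ}
    (hr : HasOrdAtImInfty (slashD k f (DCover.ofInt γ ε)) r) :
    CuspOrder (fun τ => weightZeroForm D N m f (γ • τ)) (12 * D * N * r - m * N) := by
  have h1 : CuspOrder (slashD k f (DCover.ofInt γ ε)) r := hr.tendsto
  have h2 := (h1.pow (12 * D * N)).mul (cuspOrder_discriminant.zpow (-(m * N)))
  simp only [weightZeroForm_smul hk N f γ ε]
  convert h2 using 1
  push_cast
  ring

end ModularForms

end Valence

end

/-! ### The valence formula in general. -/

theorem theorem5p1 (D : ℕ) [NeZero D] (k : ℚ) (hk : ∃ m : ℤ, k = (m : ℚ) / D)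
    (G : Subgroup SL(2, ℤ)) (hG : G.FiniteIndex)
    (χ : DCover.cover D G →* ℂˣ) (hχ : χ.ker.FiniteIndex)
    (f : ℍ → ℂ) (hf : IsMeromorphicModularForm D k G χ f)
    (hf0 : ¬ f =ᶠ[codiscrete ℍ] 0)
    -- arbitrary representatives `(γ c, ε c)` of the cosets in `Ḡ \ PSL(2, ℤ)`
    (γ : CosetSpace G → SL(2, ℤ)) (hγ : ∀ c, cosetMk G (γ c) = c)
    (ε : CosetSpace G → rootsOfUnity D ℂ)
    -- arbitrary representatives of the orbits in `Ḡ \ ℍ`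
    (ρ : OrbitSpace G → ℍ) (hρ : ∀ x, orbitMk G (ρ x) = x) :
    (∀ c, HasOrdAtImInfty (slashD k f (DCover.ofInt (γ c) (ε c)))
      (ordAtImInfty (slashD k f (DCover.ofInt (γ c) (ε c))))) ∧
    {x : OrbitSpace G | ordAt f (ρ x) ≠ 0}.Finite ∧
    (∑ᶠ c : CosetSpace G, ordAtImInfty (slashD k f (DCover.ofInt (γ c) (ε c))))
      + (∑ᶠ x : OrbitSpace G,
          (1 : ℚ) / (Nat.card (MulAction.stabilizer (barSubgroup G) (ρ x)) : ℚ)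
            * ((ordAt f (ρ x)).untop₀ : ℚ))
      = 1 / 12 * ((barSubgroup G).index : ℚ) * k := by
  obtain ⟨m, hm⟩ := hk
  have hord := fun c => Valence.hasOrdAtImInfty_ordAtImInfty
    (Valence.hasOrdAtImInfty_slashD hf hf0 (γ c) (ε c))
  have hfm : Valence.IsMeromorphic f := hf.meromorphic
  have hne := hfm.ordAt_ne_top_of_not_eventually_zero hf0
  have hGbar : (barSubgroup G).FiniteIndex :=
    ⟨ne_zero_of_dvd_ne_zero hG.index_ne_zero
      (Subgroup.index_map_dvd G (QuotientGroup.mk'_surjective _))⟩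
  have hfinC : Finite (CosetSpace G) :=
    Finite.of_equiv _ (QuotientGroup.quotientRightRelEquivQuotientLeftRel (barSubgroup G)).symm
  have hcard : Nat.card (CosetSpace G) = (barSubgroup G).index :=
    Nat.card_congr (QuotientGroup.quotientRightRelEquivQuotientLeftRel (barSubgroup G))
  let _ : Fintype (CosetSpace G) := Fintype.ofFinite _
  set N := χ.ker.index with hN
  have hN0 : N ≠ 0 := hχ.index_ne_zero
  have hD0 : D ≠ 0 := NeZero.ne D
  set ψ := Valence.weightZeroForm D N m f with hψ
  have hM0 : 12 * D * N ≠ 0 := by positivity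
  have hψord : ∀ τ, ordAt ψ τ = ((((12 * D * N : ℕ) : ℤ) * (ordAt f τ).untop₀ : ℤ) : WithTop ℤ) :=
    fun τ => by
      rw [hψ, Valence.ordAt_weightZeroForm hfm, WithTop.coe_mul,
        WithTop.coe_untop₀_of_ne_top (hne τ)]
      rfl
  have hψm := Valence.isMeromorphic_weightZeroForm hfm D N m
  have hψinv := Valence.weightZeroForm_invariant hm hf
  have hψcusp := fun c => Valence.cuspOrder_weightZeroForm hm N (hord c)
  have hγ' : ∀ c, (Quotient.mk _ (QuotientGroup.mk (γ c) : PSL(2, ℤ)) : CosetSpace G) = c := hγ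
  refine ⟨hord, ?_, ?_⟩
  · refine (Valence.finite_orbits_ordAt_ne_zero hψm hψinv hγ' hψcusp hρ).subset fun x hx h => hx ?_
    have h1 := (hψord (ρ x)).symm.trans h
    have h2 : ((12 * D * N : ℕ) : ℤ) * (ordAt f (ρ x)).untop₀ = 0 := by exact_mod_cast h1
    have h3 := (mul_eq_zero.mp h2).resolve_left (by exact_mod_cast hM0)
    rw [← WithTop.coe_untop₀_of_ne_top (hne (ρ x)), h3]
    rfl
  · have hval := Valence.valence_weight_zero hψm (fun τ => by
      rw [← hψ, hψord]
      exact WithTop.coe_ne_top) hψinv hγ'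
      hψcusp hρ
    rw [← hψ] at hval
    have hterm : ∀ x : OrbitSpace G,
        (1 : ℚ) / (Nat.card (MulAction.stabilizer (barSubgroup G) (ρ x)) : ℚ)
          * ((ordAt ψ (ρ x)).untop₀ : ℚ)
        = (12 * D * N : ℚ) * ((1 : ℚ) / (Nat.card (MulAction.stabilizer (barSubgroup G) (ρ x)) : ℚ)
            * ((ordAt f (ρ x)).untop₀ : ℚ)) := fun x => by
      rw [hψord, WithTop.untop₀_coe]
      push_cast
      ring
    rw [finsum_congr hterm, ← mul_finsum, Finset.sum_sub_distrib, ← Finset.mul_sum,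
      Finset.sum_const, Finset.card_univ, ← Nat.card_eq_fintype_card, hcard, nsmul_eq_mul] at hval
    rw [finsum_eq_sum_of_fintype]
    have hkD : (D : ℚ) * k = m := by
      rw [hm, mul_div_cancel₀ _ (by exact_mod_cast hD0)]
    have hM0' : (12 * D * N : ℚ) ≠ 0 := by exact_mod_cast hM0
    refine mul_left_cancel₀ hM0' ?_
    -- Each coset contributes -mN through Δ^(-mN), in total -mN times the index; with m = Dk and
    -- after division by 12DN this is the right-hand side.
    linear_combination hval - (N * (barSubgroup G).index : ℚ) * hkD
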